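/- Let $\Bbbk$ be a field of characteristic $0$ and let $A$ be a commutative (associative, unital) $\Bbbk$-algebra. A Lie–Rinehart algebra over $A$ is a $\Bbbk$-Lie algebra $\mathfrak g$ with an $A$-module structure (extending its $\Bbbk$-vector space structure) and a morphism of Lie algebras $\omega\colon\mathfrak g\to\mathrm{Der}_{\Bbbk}(A)$ such that $\omega(aX)=a\,\omega(X)$ and $[X,aY]=a[X,Y]+\omega(X)(a)\,Y$ for all $a\in A$ and $X,Y\in\mathfrak g$. Its universal enveloping algebra $\mathcal U_A(\mathfrak g)$ is the universal $\Bbbk$-algebra equipped with a morphism of $\Bbbk$-algebras $\iota_A\colon A\to\mathcal U_A(\mathfrak g)$ and a morphism of $\Bbbk$-Lie algebras $\iota_{\mathfrak g}\colon\mathfrak g\to\mathcal U_A(\mathfrak g)$ (with the commutator bracket on the target) such that $\iota_{\mathfrak g}(aX)=\iota_A(a)\iota_{\mathfrak g}(X)$ and $\iota_{\mathfrak g}(X)\iota_A(a)-\iota_A(a)\iota_{\mathfrak g}(X)=\iota_A(\omega(X)(a))$ for all $a\in A$, $X\in\mathfrak g$. Let $\mathfrak g$ be a Lie–Rinehart algebra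 over $A$ and let $\mathfrak h\subseteq\mathfrak g$ be a Lie–Rinehart subalgebra, that is, an $A$-submodule closed under the bracket, with the restricted anchor. Suppose that the $A$-modules $\mathfrak h$, $\mathfrak g$ and $\mathfrak g/\mathfrak h$ are projective. Then there is an isomorphism $$\mathcal U_A(\mathfrak g)\;\cong\;\mathcal U_A(\mathfrak h)\otimes_A\mathcal S_A(\mathfrak g/\mathfrak h)$$ of left $\mathcal U_A(\mathfrak h)$-modules. Here $\mathcal S_A(\mathfrak g/\mathfrak h)$ is the symmetric algebra of the $A$-module $\mathfrak g/\mathfrak h$; the tensor product is formed with respect to the right $A$-module structure $u\cdot a=u\,\iota_A(a)$ on $\mathcal U_A(\mathfrak h)$; $\mathcal U_A(\mathfrak h)$ acts on the tensor product by left multiplication on the first factor, and on $\mathcal U_A(\mathfrak g)$ by left multiplication through the algebra morphism $\mathcal U_A(\mathfrak h)\to\mathcal U_A(\mathfrak g)$ induced by the inclusion. In particular, $\mathcal U_A(\mathfrak g)$ is a projective left $\mathcal U_A(\mathfrak h)$-module. -/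

import Mathlib

open scoped TensorProduct LieRinehartAlgebra

noncomputable section

namespace LieRinehartUEA

section Construction

variable (k A L : Type*) [CommRing k] [CommRing A] [Algebra k A] [LieRing L] [LieAlgebra k L]
  [Module A L] [LieRingModule L A]

/-- The defining relations of the universal enveloping algebra of a Lie-Rinehart algebra `(A, L)`,
imposed on the tensor `k`-algebra of the `k`-module `A × L`: the map `a ↦ (a, 0)` becomes a
morphism of `k`-algebras, the map `x ↦ (0, x)` becomes a morphism of Lie algebras, and the two maps
are compatible with the `A`-module structure of `L` and with the anchor `x ↦ (a ↦ ⁅x, a⁆)`. -/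
inductive Rel : TensorAlgebra k (A × L) → TensorAlgebra k (A × L) → Prop
  | one : Rel (TensorAlgebra.ι k ((1 : A), (0 : L))) 1
  | mul (a b : A) : Rel (TensorAlgebra.ι k (a * b, (0 : L)))
      (TensorAlgebra.ι k (a, (0 : L)) * TensorAlgebra.ι k (b, (0 : L)))
  | lie (x y : L) : Rel (TensorAlgebra.ι k ((0 : A), ⁅x, y⁆))
      (TensorAlgebra.ι k ((0 : A), x) * TensorAlgebra.ι k ((0 : A), y) -
        TensorAlgebra.ι k ((0 : A), y) * TensorAlgebra.ι k ((0 : A), x))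
  | smul (a : A) (x : L) : Rel (TensorAlgebra.ι k ((0 : A), a • x))
      (TensorAlgebra.ι k (a, (0 : L)) * TensorAlgebra.ι k ((0 : A), x))
  | anchor (x : L) (a : A) : Rel (TensorAlgebra.ι k (⁅x, a⁆, (0 : L)))
      (TensorAlgebra.ι k ((0 : A), x) * TensorAlgebra.ι k (a, (0 : L)) -
        TensorAlgebra.ι k (a, (0 : L)) * TensorAlgebra.ι k ((0 : A), x))

/-- The universal enveloping algebra `U_A(L)` of a Lie-Rinehart algebra `(A, L)` over `k`.
Its universal property is given by `lift`, `lift_ιA`, `lift_ιL` and `hom_ext`. -/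
def UEA : Type _ := RingQuot (Rel k A L)

instance : Ring (UEA k A L) := inferInstanceAs (Ring (RingQuot (Rel k A L)))

instance : Algebra k (UEA k A L) := inferInstanceAs (Algebra k (RingQuot (Rel k A L)))

/-- The quotient map from the tensor algebra. -/
def mk : TensorAlgebra k (A × L) →ₐ[k] UEA k A L := RingQuot.mkAlgHom k (Rel k A L)

variable {k A L} in
theorem mk_rel {s t : TensorAlgebra k (A × L)} (h : Rel k A L s t) :
    mk k A L s = mk k A L t := RingQuot.mkAlgHom_rel k h

/-- The canonical morphism of `k`-algebras `A → U_A(L)`. -/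
def ιA : A →ₐ[k] UEA k A L :=
  AlgHom.ofLinearMap
    ((mk k A L).toLinearMap ∘ₗ TensorAlgebra.ι k ∘ₗ LinearMap.inl k A L)
    (by simpa using mk_rel (Rel.one (k := k) (A := A) (L := L)))
    (fun a b => by simpa using mk_rel (Rel.mul (k := k) (L := L) a b))

/-- The canonical map `L → U_A(L)`; by `ιL_lie` it is a morphism of Lie algebras over `k`. -/
def ιL : L →ₗ[k] UEA k A L :=
  (mk k A L).toLinearMap ∘ₗ TensorAlgebra.ι k ∘ₗ LinearMap.inr k A L

theorem ιA_apply (a : A) : ιA k A L a = mk k A L (TensorAlgebra.ι k (a, (0 : L))) := rfl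

theorem ιL_apply (x : L) : ιL k A L x = mk k A L (TensorAlgebra.ι k ((0 : A), x)) := rfl

theorem ιL_lie (x y : L) :
    ιL k A L ⁅x, y⁆ = ιL k A L x * ιL k A L y - ιL k A L y * ιL k A L x := by
  simpa [ιA_apply, ιL_apply] using mk_rel (Rel.lie (k := k) (A := A) x y)

theorem ιL_smul (a : A) (x : L) : ιL k A L (a • x) = ιA k A L a * ιL k A L x := by
  simpa [ιA_apply, ιL_apply] using mk_rel (Rel.smul (k := k) a x)

theorem ιL_mul_ιA_sub (x : L) (a : A) :
    ιL k A L x * ιA k A L a - ιA k A L a * ιL k A L x = ιA k A L ⁅x, a⁆ := by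
  simpa [ιA_apply, ιL_apply] using (mk_rel (Rel.anchor (k := k) x a)).symm

variable {k A L}

section Lift

variable {B : Type*} [Ring B] [Algebra k B] (f : A →ₐ[k] B) (g : L →ₗ[k] B)
  (hlie : ∀ x y : L, g ⁅x, y⁆ = g x * g y - g y * g x)
  (hsmul : ∀ (a : A) (x : L), g (a • x) = f a * g x)
  (hanchor : ∀ (x : L) (a : A), g x * f a - f a * g x = f ⁅x, a⁆)

/-- Existence part of the universal property of `U_A(L)`. -/
def lift : UEA k A L →ₐ[k] B :=
  RingQuot.liftAlgHom k ⟨TensorAlgebra.lift k (f.toLinearMap.coprod g), by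
    intro s t h
    induction h with
    | one => simp
    | mul a b => simp
    | lie x y => simp [hlie]
    | smul a x => simp [hsmul]
    | anchor x a => simp [hanchor]⟩

@[simp]
theorem lift_ιA (a : A) : lift f g hlie hsmul hanchor (ιA k A L a) = f a := by
  exact (RingQuot.liftAlgHom_mkAlgHom_apply _ _ _ _).trans (by simp)

@[simp]
theorem lift_ιL (x : L) : lift f g hlie hsmul hanchor (ιL k A L x) = g x := by
  exact (RingQuot.liftAlgHom_mkAlgHom_apply _ _ _ _).trans (by simp)

end Lift

/-- Uniqueness part of the universal property of `U_A(L)`. -/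
theorem hom_ext {B : Type*} [Ring B] [Algebra k B] {F G : UEA k A L →ₐ[k] B}
    (hA : ∀ a, F (ιA k A L a) = G (ιA k A L a)) (hL : ∀ x, F (ιL k A L x) = G (ιL k A L x)) :
    F = G := by
  apply RingQuot.ringQuot_ext'
  apply TensorAlgebra.hom_ext
  ext x
  · exact hA x
  · exact hL x

/-- The morphism `U_A(f) : U_A(L) → U_A(L')` induced by a morphism of Lie-Rinehart algebras over
the same base algebra `A`. -/
def map {L' : Type*} [LieRing L'] [LieAlgebra k L'] [Module A L'] [LieRingModule L' A]
    (f : L →ₗ⁅AlgHom.id k A⁆ L') : UEA k A L →ₐ[k] UEA k A L' :=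
  lift (ιA k A L') (ιL k A L' ∘ₗ (f.toLieHom : L →ₗ[k] L'))
    (fun x y => by simp [ιL_lie])
    (fun a x => by
      have h := f.map_smul_apply' a x
      simp only [LinearMap.comp_apply, LieHom.coe_toLinearMap, h, AlgHom.id_apply, ιL_smul])
    (fun x a => by
      have h := f.apply_lie' a x
      simp only [AlgHom.id_apply] at h
      simp only [LinearMap.comp_apply, LieHom.coe_toLinearMap, ιL_mul_ιA_sub, h])

@[simp]
theorem map_ιA {L' : Type*} [LieRing L'] [LieAlgebra k L'] [Module A L'] [LieRingModule L' A]
    (f : L →ₗ⁅AlgHom.id k A⁆ L') (a : A) : map f (ιA k A L a) = ιA k A L' a := by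
  simp [map]

@[simp]
theorem map_ιL {L' : Type*} [LieRing L'] [LieAlgebra k L'] [Module A L'] [LieRingModule L' A]
    (f : L →ₗ⁅AlgHom.id k A⁆ L') (x : L) : map f (ιL k A L x) = ιL k A L' (f x) := by
  simp [map]

end Construction

section RightRegular

variable (k A L : Type*) [CommRing k] [CommRing A] [Algebra k A] [LieRing L] [LieAlgebra k L]
  [Module A L] [LieRingModule L A]

/-- `U_A(L)` viewed as a `(U_A(L), A)`-bimodule: `U_A(L)` acts by left multiplication and the
commutative algebra `A` acts by right multiplication, `a • u = u * ιA a`. The tensor product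
`RightReg k A L ⊗[A] M` is thus formed with respect to the right `A`-module structure of `U_A(L)`,
and it is a left `U_A(L)`-module through its left factor. -/
def RightReg : Type _ := UEA k A L

instance : AddCommGroup (RightReg k A L) := inferInstanceAs (AddCommGroup (UEA k A L))

instance : Module (UEA k A L) (RightReg k A L) :=
  inferInstanceAs (Module (UEA k A L) (UEA k A L))

instance : Module A (RightReg k A L) where
  smul a u := ((show UEA k A L from u) * ιA k A L a : UEA k A L)
  one_smul u := by
    change (show UEA k A L from u) * ιA k A L 1 = u
    rw [map_one, mul_one]
  mul_smul a b u := by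
    change (show UEA k A L from u) * ιA k A L (a * b) =
      ((show UEA k A L from u) * ιA k A L b) * ιA k A L a
    rw [mul_comm a b, map_mul, mul_assoc]
  smul_zero a := zero_mul (ιA k A L a)
  smul_add a u v := add_mul (show UEA k A L from u) (show UEA k A L from v) (ιA k A L a)
  add_smul a b u := by
    change (show UEA k A L from u) * ιA k A L (a + b) =
      (show UEA k A L from u) * ιA k A L a + (show UEA k A L from u) * ιA k A L b
    rw [map_add, mul_add]
  zero_smul u := by
    change (show UEA k A L from u) * ιA k A L 0 = 0
    rw [map_zero, mul_zero]

instance : SMulCommClass A (UEA k A L) (RightReg k A L) where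
  smul_comm a u v := mul_assoc u (show UEA k A L from v) (ιA k A L a)

end RightRegular

section Subalgebra

variable {k A L : Type*} [CommRing k] [CommRing A] [Algebra k A] [LieRing L] [LieAlgebra k L]
  [Module A L] [LieRingModule L A] [LieRinehartRing A L] [LieRinehartAlgebra k A L]

/-- For a Lie-Rinehart subalgebra `H` of `L`, the algebra `U_A(L)` is a left `U_A(H)`-module by
left multiplication along the morphism `U_A(H) → U_A(L)` induced by the inclusion. -/
instance (H : LieRinehartSubalgebra A L) : Module (UEA k A H) (UEA k A L) :=
  Module.compHom (UEA k A L) (map (H.incl k)).toRingHom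

end Subalgebra

end LieRinehartUEA

end

/-! Write `S` for symmetric algebras and `U` for enveloping algebras. Every positive integer is
invertible in `A`, so Euler's identity recovers an element of positive weight from its derivative;
all maps below are built by recursion on the weight with such a division. Projectivity supplies
connections: additive operators obeying the Leibniz rule for the anchor. Two operators with the same
Leibniz rule differ by an `A`-linear map, so the classical formulas for Lie algebras over a field
become `A`-linear once a connection is subtracted.

Flat model: `exists_flat_connection` deforms a graded connection on `S(L)` into a flat one whose
operators are multiplication by `x` up to lower degree. By `exists_ringHom_of_flat` this is an
action `R` of `U(L)` on `S(L)`, with orbit map `u ↦ R u 1`.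

Symmetrization: `exists_symmetrization` averages products over the order of their factors. It yields
`φ : S(L/H) → U(L)`, which extends to the desired `U(H)`-linear map `Φ : U(H) ⊗ S(L/H) → U(L)`, and
also `χ : S(L) → U(H) ⊗ S(L/H)`.

The composite of `χ`, `Φ` and the orbit map is an endomorphism of `S(L)` equal to the identity up to
lower degree (`symmetrization_symbol`), hence bijective. The map `χ` is surjective, because its
range contains every `1 ⊗ p` and is stable under `H` (`apply_mem_range_symmetrization`); so `Φ` is
injective. The orbit map is injective by the same argument for the symmetrization `S(L) → U(L)`
(`orbit_injective`); so `Φ` is surjective.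

Projectivity of `U(L)` over `U(H)` follows, since `S(L/H)` is projective over `A` and induction from
`A` to `U(H)` preserves projectivity. -/

namespace SymmetricAlgebra

open Polynomial

/-! ### Weight gradings and the degree filtration of a symmetric algebra -/

section Grading

variable {A W : Type*} [CommRing A] [AddCommGroup W] [Module A W]

@[elab_as_elim]
theorem induction_left {motive : SymmetricAlgebra A W → Prop} (one : motive 1)
    (smul : ∀ (a : A) q, motive q → motive (a • q))
    (mul : ∀ y q, motive q → motive (ι A W y * q))
    (add : ∀ p q, motive p → motive q → motive (p + q)) (q : SymmetricAlgebra A W) :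
    motive q := by
  have key : ∀ p q : SymmetricAlgebra A W, motive q → motive (p * q) := by
    intro p
    induction p using SymmetricAlgebra.induction with
    | algebraMap r => intro q hq; rw [← Algebra.smul_def]; exact smul r q hq
    | ι x => exact mul x
    | mul a b ha hb => intro q hq; rw [mul_assoc]; exact ha _ (hb _ hq)
    | add a b ha hb => intro q hq; rw [add_mul]; exact add _ _ (ha _ hq) (hb _ hq)
  simpa using key q 1 one

/-- The algebra morphism `S(W) → S(W)[X]` multiplying the image of `e` by `X`; for an idempotent `e`
its coefficients are the projections to the homogeneous components for the degree in which
the image of `e` has weight one and the kernel of `e` has weight zero. -/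
noncomputable def weightHom (e : W →ₗ[A] W) :
    SymmetricAlgebra A W →ₐ[A] (SymmetricAlgebra A W)[X] :=
  lift ((CAlgHom (R := A) (A := SymmetricAlgebra A W)).toLinearMap ∘ₗ ι A W ∘ₗ (LinearMap.id - e) +
    LinearMap.mulRight A (X : (SymmetricAlgebra A W)[X]) ∘ₗ
      (CAlgHom (R := A) (A := SymmetricAlgebra A W)).toLinearMap ∘ₗ ι A W ∘ₗ e)

theorem weightHom_ι (e : W →ₗ[A] W) (y : W) :
    weightHom e (ι A W y) = C (ι A W (y - e y)) + C (ι A W (e y)) * X := by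
  rw [weightHom, lift_ι_apply]
  simp [CAlgHom]

/-- The component of weight `i`. -/
noncomputable def weightProj (e : W →ₗ[A] W) (i : ℕ) :
    SymmetricAlgebra A W →ₗ[A] SymmetricAlgebra A W :=
  ((lcoeff (SymmetricAlgebra A W) i).restrictScalars A) ∘ₗ (weightHom e).toLinearMap

theorem weightProj_apply (e : W →ₗ[A] W) (i : ℕ) (q : SymmetricAlgebra A W) :
    weightProj e i q = (weightHom e q).coeff i := rfl

theorem weightProj_zero_one (e : W →ₗ[A] W) : weightProj e 0 (1 : SymmetricAlgebra A W) = 1 := by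
  simp [weightProj_apply]

theorem weightProj_succ_one (e : W →ₗ[A] W) (i : ℕ) :
    weightProj e (i + 1) (1 : SymmetricAlgebra A W) = 0 := by
  simp [weightProj_apply, coeff_one]

theorem weightProj_zero_ι_mul (e : W →ₗ[A] W) (y : W) (q : SymmetricAlgebra A W) :
    weightProj e 0 (ι A W y * q) = ι A W (y - e y) * weightProj e 0 q := by
  simp only [weightProj_apply, map_mul, weightHom_ι, add_mul, coeff_add, coeff_C_mul, mul_assoc,
    coeff_X_mul_zero, mul_zero, add_zero]

theorem weightProj_succ_ι_mul (e : W →ₗ[A] W) (i : ℕ) (y : W) (q : SymmetricAlgebra A W) :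
    weightProj e (i + 1) (ι A W y * q) =
      ι A W (y - e y) * weightProj e (i + 1) q + ι A W (e y) * weightProj e i q := by
  simp only [weightProj_apply, map_mul, weightHom_ι, add_mul, coeff_add, coeff_C_mul, mul_assoc,
    coeff_X_mul]

theorem weightProj_eq_zero_of_natDegree_lt {e : W →ₗ[A] W} {i : ℕ} {q : SymmetricAlgebra A W}
    (h : (weightHom e q).natDegree < i) : weightProj e i q = 0 :=
  coeff_eq_zero_of_natDegree_lt h

theorem weightProj_comm {e e' : W →ₗ[A] W} (h : ∀ y, e (e' y) = e' (e y)) (i j : ℕ)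
    (q : SymmetricAlgebra A W) :
    weightProj e i (weightProj e' j q) = weightProj e' j (weightProj e i q) := by
  induction q using induction_left generalizing i j with
  | one =>
    cases i <;> cases j <;> simp [weightProj_zero_one, weightProj_succ_one]
  | smul a q hq => simp only [map_smul, hq]
  | add p q hp hq => simp only [map_add, hp, hq]
  | mul y q hq =>
    cases i <;> cases j <;>
      simp only [weightProj_zero_ι_mul, weightProj_succ_ι_mul, map_add, hq] <;>
      simp only [map_sub, h] <;> ring

/-- Idempotency of `e` makes `y - e y` and `e y` of pure weight zero and one; this is what turns the
coefficients of `weightHom` into orthogonal projections. -/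
theorem weightProj_weightProj {e : W →ₗ[A] W} (h : ∀ y, e (e y) = e y) (i j : ℕ)
    (q : SymmetricAlgebra A W) :
    weightProj e i (weightProj e j q) = if i = j then weightProj e j q else 0 := by
  induction q using induction_left generalizing i j with
  | one =>
    cases i <;> cases j <;> simp [weightProj_zero_one, weightProj_succ_one]
  | smul a q hq => simp only [map_smul, hq]; split_ifs <;> simp
  | add p q hp hq => simp only [map_add, hp, hq]; split_ifs <;> simp
  | mul y q hq =>
    cases i <;> cases j <;>
      simp only [weightProj_zero_ι_mul, weightProj_succ_ι_mul, map_add, hq] <;>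
      simp only [map_sub, h, sub_self, sub_zero, zero_mul, add_zero, zero_add, Nat.add_right_cancel_iff,
        map_zero, reduceCtorEq, if_true, if_false, mul_zero]
    split_ifs <;> simp

theorem weightProj_self {e : W →ₗ[A] W} (h : ∀ y, e (e y) = e y) (i : ℕ)
    (q : SymmetricAlgebra A W) : weightProj e i (weightProj e i q) = weightProj e i q := by
  simp [weightProj_weightProj h]

/-- Evaluating `weightHom e` at `X = 1` gives back the identity, whether or not `e` is idempotent.
-/
theorem sum_weightProj (e : W →ₗ[A] W) {q : SymmetricAlgebra A W} {n : ℕ}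
    (hn : (weightHom e q).natDegree < n) : ∑ i ∈ Finset.range n, weightProj e i q = q := by
  have h : ((aeval (1 : SymmetricAlgebra A W)).restrictScalars A).comp (weightHom e) =
      AlgHom.id A _ := by
    apply algHom_ext
    ext y
    simp [weightHom_ι]
  have h2 := DFunLike.congr_fun h q
  simp only [AlgHom.comp_apply, AlgHom.restrictScalars_apply, AlgHom.id_apply,
    aeval_eq_sum_range' hn, one_pow, smul_eq_mul, mul_one] at h2
  exact h2

/-- The additive map acting by `f i` on the component of weight `i`. -/
noncomputable def gather (e : W →ₗ[A] W) {M : Type*} [AddCommGroup M]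
    (f : ℕ → SymmetricAlgebra A W →+ M) : SymmetricAlgebra A W →+ M where
  toFun q := (weightHom e q).sum fun i c => f i c
  map_zero' := by simp
  map_add' p q := by
    rw [map_add]
    exact sum_add_index _ _ _ (fun _ => map_zero _) (fun _ _ _ => map_add _ _ _)

theorem gather_apply (e : W →ₗ[A] W) {M : Type*} [AddCommGroup M]
    (f : ℕ → SymmetricAlgebra A W →+ M) {q : SymmetricAlgebra A W} {n : ℕ}
    (hn : (weightHom e q).natDegree < n) :
    gather e f q = ∑ i ∈ Finset.range n, f i (weightProj e i q) :=
  sum_over_range' _ (fun _ => map_zero _) _ hn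

theorem gather_weightProj {e : W →ₗ[A] W} (he : ∀ y, e (e y) = e y) {M : Type*} [AddCommGroup M]
    (f : ℕ → SymmetricAlgebra A W →+ M) (i : ℕ) (q : SymmetricAlgebra A W) :
    gather e f (weightProj e i q) = f i (weightProj e i q) := by
  -- The bound must exceed `i` as well as the degree, so that the index `i` occurs in the sum.
  rw [gather_apply e f (n := max ((weightHom e (weightProj e i q)).natDegree + 1) (i + 1))
    (by omega), Finset.sum_eq_single i]
  · rw [weightProj_self he]
  · intro j _ hj
    rw [weightProj_weightProj he, if_neg hj, map_zero]
  · intro h; simp at h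

/-- The linear version of `gather`. -/
noncomputable def gatherLinear (e : W →ₗ[A] W) {M : Type*} [AddCommGroup M] [Module A M]
    (f : ℕ → SymmetricAlgebra A W →ₗ[A] M) : SymmetricAlgebra A W →ₗ[A] M :=
  { gather e fun i => (f i).toAddMonoidHom with
    map_smul' := by
      intro a q
      have hN : (weightHom e (a • q)).natDegree < max ((weightHom e (a • q)).natDegree + 1)
        ((weightHom e q).natDegree + 1) := by omega
      have hN' : (weightHom e q).natDegree < max ((weightHom e (a • q)).natDegree + 1)
        ((weightHom e q).natDegree + 1) := by omega
      change gather e _ _ = a • gather e _ _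
      rw [gather_apply _ _ hN, gather_apply _ _ hN', Finset.smul_sum]
      simp }

theorem gatherLinear_apply (e : W →ₗ[A] W) {M : Type*} [AddCommGroup M] [Module A M]
    (f : ℕ → SymmetricAlgebra A W →ₗ[A] M) {q : SymmetricAlgebra A W} {n : ℕ}
    (hn : (weightHom e q).natDegree < n) :
    gatherLinear e f q = ∑ i ∈ Finset.range n, f i (weightProj e i q) :=
  gather_apply e (fun i => (f i).toAddMonoidHom) hn

theorem gatherLinear_weightProj {e : W →ₗ[A] W} (he : ∀ y, e (e y) = e y) {M : Type*}
    [AddCommGroup M] [Module A M] (f : ℕ → SymmetricAlgebra A W →ₗ[A] M) (i : ℕ)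
    (q : SymmetricAlgebra A W) :
    gatherLinear e f (weightProj e i q) = f i (weightProj e i q) :=
  gather_weightProj he (fun i => (f i).toAddMonoidHom) i q

/-- To prove an additive property, it is enough to consider elements of fixed weight. -/
theorem induction_weight (e : W →ₗ[A] W) {motive : SymmetricAlgebra A W → Prop}
    (q : SymmetricAlgebra A W) (zero : motive 0) (add : ∀ p q, motive p → motive q → motive (p + q))
    (proj : ∀ i, motive (weightProj e i q)) : motive q := by
  rw [← sum_weightProj e (Nat.lt_succ_self (weightHom e q).natDegree)]
  exact Finset.sum_induction _ motive add zero fun i _ => proj i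

variable (A W) in
/-- The submodule of elements of degree less than `n`. -/
noncomputable def degreeLT (n : ℕ) : Submodule A (SymmetricAlgebra A W) :=
  ⨅ (m : ℕ) (_ : n ≤ m), LinearMap.ker (weightProj LinearMap.id m)

theorem mem_degreeLT {n : ℕ} {q : SymmetricAlgebra A W} :
    q ∈ degreeLT A W n ↔ ∀ m, n ≤ m → weightProj LinearMap.id m q = 0 := by
  simp [degreeLT, Submodule.mem_iInf]

theorem degreeLT_mono : Monotone (degreeLT A W) := fun _ _ h _ hq =>
  mem_degreeLT.2 fun i hi => mem_degreeLT.1 hq i (h.trans hi)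

theorem exists_mem_degreeLT (q : SymmetricAlgebra A W) : ∃ n, q ∈ degreeLT A W n :=
  ⟨_, mem_degreeLT.2 fun _ hm =>
    weightProj_eq_zero_of_natDegree_lt (Nat.lt_of_lt_of_le (Nat.lt_succ_self _) hm)⟩

theorem degreeLT_zero : degreeLT A W 0 = ⊥ := by
  rw [eq_bot_iff]
  intro q hq
  rw [mem_degreeLT] at hq
  rw [Submodule.mem_bot, ← sum_weightProj LinearMap.id (q := q) (Nat.lt_succ_self _)]
  exact Finset.sum_eq_zero fun i _ => hq i (Nat.zero_le i)

theorem eq_zero_of_mem_degreeLT_zero {q : SymmetricAlgebra A W} (h : q ∈ degreeLT A W 0) :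
    q = 0 := by
  rwa [degreeLT_zero, Submodule.mem_bot] at h

theorem weightProj_mem_degreeLT (m n : ℕ) (h : m < n) (q : SymmetricAlgebra A W) :
    weightProj LinearMap.id m q ∈ degreeLT A W n :=
  mem_degreeLT.2 fun j hj => by
    rw [weightProj_weightProj (fun _ => rfl), if_neg (by omega)]

theorem weightProj_mem_degreeLT_of_mem (e : W →ₗ[A] W) (i : ℕ) {n : ℕ} {q : SymmetricAlgebra A W}
    (h : q ∈ degreeLT A W n) : weightProj e i q ∈ degreeLT A W n :=
  mem_degreeLT.2 fun j hj => by
    rw [weightProj_comm (e := LinearMap.id) (e' := e) (fun _ => rfl), mem_degreeLT.1 h j hj, map_zero]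

theorem sub_weightProj_mem_degreeLT {n : ℕ} {q : SymmetricAlgebra A W}
    (h : q ∈ degreeLT A W (n + 1)) : q - weightProj LinearMap.id n q ∈ degreeLT A W n :=
  mem_degreeLT.2 fun j hj => by
    rw [map_sub, weightProj_weightProj (fun _ => rfl)]
    rcases hj.eq_or_lt with rfl | hj
    · simp
    · rw [mem_degreeLT.1 h j hj, if_neg (by omega), sub_zero]

theorem ι_mul_mem_degreeLT (y : W) {n : ℕ} {q : SymmetricAlgebra A W} (h : q ∈ degreeLT A W n) :
    ι A W y * q ∈ degreeLT A W (n + 1) :=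
  mem_degreeLT.2 fun j hj => by
    obtain ⟨j, rfl⟩ := Nat.exists_eq_succ_of_ne_zero (show j ≠ 0 by omega)
    rw [weightProj_succ_ι_mul]
    simp [mem_degreeLT.1 h j (by omega)]

theorem sum_weightProj_of_mem_degreeLT {n : ℕ} {q : SymmetricAlgebra A W}
    (h : q ∈ degreeLT A W n) : ∑ i ∈ Finset.range n, weightProj LinearMap.id i q = q := by
  have h1 : (weightHom LinearMap.id q).natDegree < max n ((weightHom LinearMap.id q).natDegree + 1) :=
    by omega
  conv_rhs => rw [← sum_weightProj LinearMap.id h1]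
  apply Finset.sum_subset
  · intro i; simp; omega
  · intro i _ hi
    exact mem_degreeLT.1 h i (by simpa using hi)

end Grading

/-! ### Functoriality and projectivity of the symmetric algebra -/

section Map

variable {A V W : Type*} [CommRing A] [AddCommGroup V] [Module A V] [AddCommGroup W] [Module A W]

/-- The algebra morphism between symmetric algebras induced by a linear map. -/
noncomputable def mapHom (f : V →ₗ[A] W) : SymmetricAlgebra A V →ₐ[A] SymmetricAlgebra A W :=
  lift (ι A W ∘ₗ f)

@[simp]
theorem mapHom_ι (f : V →ₗ[A] W) (v : V) : mapHom f (ι A V v) = ι A W (f v) := by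
  rw [mapHom, lift_ι_apply]; rfl

theorem mapHom_mapHom {X : Type*} [AddCommGroup X] [Module A X] (g : W →ₗ[A] X) (f : V →ₗ[A] W)
    (q : SymmetricAlgebra A V) : mapHom g (mapHom f q) = mapHom (g ∘ₗ f) q := by
  have : (mapHom g).comp (mapHom f) = mapHom (g ∘ₗ f) := by
    apply algHom_ext
    ext y
    simp
  exact DFunLike.congr_fun this q

theorem mapHom_id (q : SymmetricAlgebra A V) : mapHom (LinearMap.id : V →ₗ[A] V) q = q := by
  have : mapHom (LinearMap.id : V →ₗ[A] V) = AlgHom.id A _ := by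
    apply algHom_ext
    ext y
    simp
  exact DFunLike.congr_fun this q

theorem weightProj_mapHom {f : V →ₗ[A] W} {e : V →ₗ[A] V} {e' : W →ₗ[A] W}
    (h : ∀ v, e' (f v) = f (e v)) (i : ℕ) (q : SymmetricAlgebra A V) :
    weightProj e' i (mapHom f q) = mapHom f (weightProj e i q) := by
  induction q using induction_left generalizing i with
  | one => cases i <;> simp [weightProj_zero_one, weightProj_succ_one]
  | smul a q hq => simp only [map_smul, hq]
  | add p q hp hq => simp only [map_add, hp, hq]
  | mul y q hq =>
    cases i <;> simp only [map_mul, mapHom_ι, weightProj_zero_ι_mul, weightProj_succ_ι_mul,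
      map_add, map_sub, hq, h]

theorem mapHom_mem_degreeLT (f : V →ₗ[A] W) {n : ℕ} {q : SymmetricAlgebra A V}
    (h : q ∈ degreeLT A V n) : mapHom f q ∈ degreeLT A W n :=
  mem_degreeLT.2 fun j hj => by
    rw [weightProj_mapHom (f := f) (e := LinearMap.id) (fun _ => rfl), mem_degreeLT.1 h j hj, map_zero]

/-- This is the specialization `X = 0` of `weightHom`. For the projection onto `H` along a
complement it identifies the weight zero part with the symmetric algebra of the complement. -/
theorem weightProj_zero_eq_mapHom (e : W →ₗ[A] W) (q : SymmetricAlgebra A W) :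
    weightProj e 0 q = mapHom (LinearMap.id - e) q := by
  induction q using induction_left with
  | one => simp [weightProj_zero_one]
  | smul a q hq => simp only [map_smul, hq]
  | add p q hp hq => simp only [map_add, hp, hq]
  | mul y q hq => simp [weightProj_zero_ι_mul, hq]

theorem weightProj_id_zero (q : SymmetricAlgebra A W) :
    weightProj LinearMap.id 0 q = algebraMap A _ (algebraMapInv q) := by
  induction q using induction_left with
  | one => simp [weightProj_zero_one]
  | smul a q hq => rw [map_smul, hq, map_smul, smul_eq_mul, map_mul, Algebra.smul_def]
  | add p q hp hq => simp only [map_add, hp, hq]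
  | mul y q hq => simp [weightProj_zero_ι_mul, algebraMapInv_ι]

/-- A splitting exhibits `S(W)` as a retract of the symmetric algebra of a free module, which is
free. -/
instance [Module.Projective A W] : Module.Projective A (SymmetricAlgebra A W) := by
  obtain ⟨s, hs⟩ := Module.projective_def'.1 ‹Module.Projective A W›
  refine Module.Projective.of_split (mapHom s).toLinearMap
    (mapHom (Finsupp.linearCombination A id)).toLinearMap ?_
  ext q
  simp only [LinearMap.comp_apply, AlgHom.toLinearMap_apply, mapHom_mapHom, hs, mapHom_id,
    LinearMap.id_apply]

end Map

/-! ### The universal derivation and Euler's identity -/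

section Derivation

variable {A W : Type*} [CommRing A] [AddCommGroup W] [Module A W]

/-- The algebra morphism to the square zero extension of `S(W)` by `S(W) ⊗ W` that has the
derivation `diff e` as its second component. -/
noncomputable def diffHom (e : W →ₗ[A] W) :
    SymmetricAlgebra A W →ₐ[A]
      TrivSqZeroExt (SymmetricAlgebra A W) (SymmetricAlgebra A W ⊗[A] W) :=
  lift ((TrivSqZeroExt.inlAlgHom A (SymmetricAlgebra A W)
      (SymmetricAlgebra A W ⊗[A] W)).toLinearMap ∘ₗ ι A W +
    ((TrivSqZeroExt.inrHom (SymmetricAlgebra A W)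
      (SymmetricAlgebra A W ⊗[A] W)).restrictScalars A) ∘ₗ
        (TensorProduct.mk A (SymmetricAlgebra A W) W 1) ∘ₗ e)

theorem diffHom_ι (e : W →ₗ[A] W) (y : W) :
    diffHom e (ι A W y) = TrivSqZeroExt.inl (ι A W y) + TrivSqZeroExt.inr (1 ⊗ₜ e y) := by
  rw [diffHom, lift_ι_apply]
  rfl

theorem fst_diffHom (e : W →ₗ[A] W) (q : SymmetricAlgebra A W) : (diffHom e q).fst = q := by
  have : (TrivSqZeroExt.fstHom A (SymmetricAlgebra A W) (SymmetricAlgebra A W ⊗[A] W)).comp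
      (diffHom e) = AlgHom.id A _ := by
    apply algHom_ext
    ext y
    simp [diffHom_ι]
  exact DFunLike.congr_fun this q

/-- The derivation `S(W) → S(W) ⊗ W` that maps `y : W` to `1 ⊗ e y`. -/
noncomputable def diff (e : W →ₗ[A] W) :
    SymmetricAlgebra A W →ₗ[A] SymmetricAlgebra A W ⊗[A] W :=
  ((TrivSqZeroExt.sndHom (SymmetricAlgebra A W)
    (SymmetricAlgebra A W ⊗[A] W)).restrictScalars A) ∘ₗ (diffHom e).toLinearMap

theorem diff_apply (e : W →ₗ[A] W) (q : SymmetricAlgebra A W) : diff e q = (diffHom e q).snd := rfl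

theorem diff_one (e : W →ₗ[A] W) : diff e 1 = 0 := by
  simp [diff_apply]

theorem diff_ι_mul (e : W →ₗ[A] W) (y : W) (q : SymmetricAlgebra A W) :
    diff e (ι A W y * q) = q ⊗ₜ e y + (LinearMap.mulLeft A (ι A W y)).rTensor W (diff e q) := by
  rw [diff_apply, map_mul, TrivSqZeroExt.snd_mul, fst_diffHom, fst_diffHom, diffHom_ι,
    diff_apply, add_comm]
  congr 1
  simp [TensorProduct.smul_tmul']

theorem diff_weightProj_zero {e e' : W →ₗ[A] W} (h : ∀ y, e (e' y) = e y)
    (q : SymmetricAlgebra A W) : diff e (weightProj e' 0 q) = 0 := by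
  induction q using induction_left with
  | one => simp [weightProj_zero_one, diff_one]
  | smul a q hq => simp only [map_smul, hq, smul_zero]
  | add p q hp hq => simp only [map_add, hp, hq, add_zero]
  | mul y q hq => rw [weightProj_zero_ι_mul, diff_ι_mul, hq, map_sub, h]; simp

/-- The hypothesis covers both `e' = e` idempotent and `e' = id`, so the derivation lowers the
weight for `e` and the total degree alike. -/
theorem diff_weightProj_succ {e e' : W →ₗ[A] W} (h : ∀ y, e (e' y) = e y) (i : ℕ)
    (q : SymmetricAlgebra A W) :
    diff e (weightProj e' (i + 1) q) = (weightProj e' i).rTensor W (diff e q) := by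
  induction q using induction_left generalizing i with
  | one => simp [weightProj_succ_one, diff_one]
  | smul a q hq => simp only [map_smul, hq]
  | add p q hp hq => simp only [map_add, hp, hq]
  | mul y q hq =>
    rw [weightProj_succ_ι_mul, map_add, diff_ι_mul, diff_ι_mul, hq, diff_ι_mul, map_add,
      LinearMap.rTensor_tmul, map_sub, h, sub_self, TensorProduct.tmul_zero, zero_add,
      add_left_comm]
    congr 1
    rw [← LinearMap.rTensor_comp_apply, ← LinearMap.rTensor_comp_apply]
    cases i with
    | zero =>
      rw [diff_weightProj_zero h, map_zero, add_zero]
      congr 2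
      ext p
      simp [weightProj_zero_ι_mul]
    | succ i =>
      rw [hq, ← LinearMap.rTensor_comp_apply, ← LinearMap.add_apply, ← LinearMap.rTensor_add]
      congr 2
      ext p
      simp [weightProj_succ_ι_mul]

/-- The contraction `p ⊗ w ↦ e w * p`. -/
noncomputable def contract (e : W →ₗ[A] W) :
    SymmetricAlgebra A W ⊗[A] W →ₗ[A] SymmetricAlgebra A W :=
  TensorProduct.lift ((LinearMap.mul A (SymmetricAlgebra A W)).flip ∘ₗ (ι A W ∘ₗ e)).flip

@[simp]
theorem contract_tmul (e : W →ₗ[A] W) (p : SymmetricAlgebra A W) (w : W) :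
    contract e (p ⊗ₜ w) = ι A W (e w) * p := by
  simp [contract, mul_comm]

theorem contract_rTensor_mulLeft (e : W →ₗ[A] W) (y : W) (t : SymmetricAlgebra A W ⊗[A] W) :
    contract e ((LinearMap.mulLeft A (ι A W y)).rTensor W t) = ι A W y * contract e t := by
  induction t with
  | zero => simp
  | tmul p w => simp [mul_left_comm]
  | add p q hp hq => simp only [map_add, hp, hq, mul_add]

/-- Euler's identity. -/
theorem contract_diff_weightProj {e : W →ₗ[A] W} (h : ∀ y, e (e y) = e y) (i : ℕ)
    (q : SymmetricAlgebra A W) :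
    contract e (diff e (weightProj e i q)) = i • weightProj e i q := by
  induction q using induction_left generalizing i with
  | one => cases i <;> simp [weightProj_zero_one, weightProj_succ_one, diff_one]
  | smul a q hq => rw [map_smul, map_smul, map_smul, hq, smul_comm]
  | add p q hp hq => simp only [map_add, hp, hq, smul_add]
  | mul y q hq =>
    cases i with
    | zero => simp [diff_weightProj_zero h]
    | succ i =>
      rw [weightProj_succ_ι_mul, map_add, map_add, diff_ι_mul, diff_ι_mul, map_add, map_add,
        contract_rTensor_mulLeft, contract_rTensor_mulLeft, hq, hq, contract_tmul, contract_tmul,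
        h, map_sub e, h, h, sub_self, map_zero (ι A W), zero_mul]
      simp only [nsmul_eq_mul, Nat.cast_add, Nat.cast_one]
      ring

/-- `diff e` lowers the degree by one. -/
theorem diff_induction {e : W →ₗ[A] W} {n : ℕ} {q : SymmetricAlgebra A W}
    (hq : q ∈ degreeLT A W (n + 1)) {motive : SymmetricAlgebra A W ⊗[A] W → Prop}
    (zero : motive 0) (add : ∀ s t, motive s → motive t → motive (s + t))
    (tmul : ∀ p w, p ∈ degreeLT A W n → motive (p ⊗ₜ w)) : motive (diff e q) := by
  rw [← sum_weightProj_of_mem_degreeLT hq, map_sum]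
  refine Finset.sum_induction _ motive add zero fun i hi => ?_
  rw [Finset.mem_range] at hi
  cases i with
  | zero => rwa [diff_weightProj_zero (fun _ => rfl)]
  | succ i =>
    rw [diff_weightProj_succ (fun _ => rfl)]
    induction diff e q with
    | zero => simpa using zero
    | tmul p w => exact tmul _ _ (weightProj_mem_degreeLT _ _ (by omega) _)
    | add p q hp hq => rw [map_add]; exact add _ _ hp hq

end Derivation

end SymmetricAlgebra

namespace LieRinehartUEA

open SymmetricAlgebra

/-! ### Connections on projective modules -/

section Connection

variable {A L : Type*} [CommRing A] [LieRing L] [Module A L] [LieRingModule L A]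

/-- A family `∇` of additive operators on `M`, depending linearly on `w : W`, satisfies the Leibniz
rule with respect to the derivations of `A` that the anchor associates with `t w`. -/
def IsConnection {W M : Type*} [AddCommGroup W] [Module A W] [AddCommGroup M] [Module A M]
    (t : W →ₗ[A] L) (D : W →ₗ[A] (M →+ M)) : Prop :=
  ∀ (w : W) (a : A) (m : M), D w (a • m) = a • D w m + ⁅t w, a⁆ • m

theorem IsConnection.comp {W X M : Type*} [AddCommGroup W] [Module A W] [AddCommGroup X]
    [Module A X] [AddCommGroup M] [Module A M] {t : W →ₗ[A] L} {D : W →ₗ[A] (M →+ M)}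
    (h : IsConnection t D) (f : X →ₗ[A] W) : IsConnection (t ∘ₗ f) (D ∘ₗ f) :=
  fun w a m => h (f w) a m

variable [LieRinehartRing A L]

/-- Embed `X` in a free module, differentiate the coordinates there, and project back. The Leibniz
rule survives because the projection splits the embedding. -/
theorem exists_connection (X : Type*) [AddCommGroup X] [Module A X] [Module.Projective A X] :
    ∃ D : L →ₗ[A] (X →+ X), IsConnection LinearMap.id D := by
  obtain ⟨s, hs⟩ := Module.projective_def'.1 ‹Module.Projective A X›
  have hs' : ∀ p, ((s p).sum fun z b => b • z) = p := fun p => by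
    simpa [Finsupp.linearCombination_apply] using DFunLike.congr_fun hs p
  let g : L → (X →₀ A) →+ X := fun x => Finsupp.liftAddHom fun z =>
    { toFun := fun b => ⁅x, b⁆ • z
      map_zero' := by simp
      map_add' := by intro a b; rw [lie_add, add_smul] }
  have hg : ∀ x f, g x f = f.sum fun z b => ⁅x, b⁆ • z := fun x f => rfl
  refine ⟨{ toFun := fun x => (g x).comp s.toAddMonoidHom, map_add' := ?_, map_smul' := ?_ }, ?_⟩
  · intro x y
    ext p
    simp only [AddMonoidHom.comp_apply, AddMonoidHom.add_apply, hg, add_lie, add_smul,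
      Finsupp.sum_add]
  · intro a x
    ext p
    simp only [AddMonoidHom.comp_apply, AddMonoidHom.smul_apply, hg, RingHom.id_apply,
      LieRinehartRing.lie_smul_eq_mul, mul_smul, Finsupp.smul_sum]
  · intro x a p
    change g x (s (a • p)) = a • g x (s p) + ⁅x, a⁆ • p
    have h1 : ⁅x, a⁆ • p = (s p).sum fun z b => ⁅x, a⁆ • b • z := by
      rw [← Finsupp.smul_sum, hs']
    rw [map_smul, hg, hg, Finsupp.sum_smul_index (by simp), h1, Finsupp.smul_sum,
      ← Finsupp.sum_add]
    refine Finsupp.sum_congr fun z _ => ?_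
    rw [LieRinehartRing.leibniz_mul_right, add_smul, smul_eq_mul, mul_smul, mul_smul]

end Connection

/-! ### Connections compatible with the gradings -/

section Average

variable {A L W : Type*} [CommRing A] [LieRing L] [Module A L] [AddCommGroup W] [Module A W]

/-- The part of a family of operators on `S(W)` that preserves the weights for `e`. -/
noncomputable def average (e : W →ₗ[A] W)
    (D : L →ₗ[A] (SymmetricAlgebra A W →+ SymmetricAlgebra A W)) :
    L →ₗ[A] (SymmetricAlgebra A W →+ SymmetricAlgebra A W) where
  toFun x := gather e fun i => (weightProj e i).toAddMonoidHom.comp (D x)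
  map_add' x y := by
    ext q
    rw [AddMonoidHom.add_apply]
    simp only [gather_apply e _ (Nat.lt_succ_self (weightHom e q).natDegree)]
    simp [Finset.sum_add_distrib]
  map_smul' a x := by
    ext q
    rw [AddMonoidHom.smul_apply]
    simp only [gather_apply e _ (Nat.lt_succ_self (weightHom e q).natDegree)]
    simp [Finset.smul_sum]

theorem average_apply (e : W →ₗ[A] W)
    (D : L →ₗ[A] (SymmetricAlgebra A W →+ SymmetricAlgebra A W)) (x : L)
    {q : SymmetricAlgebra A W} {n : ℕ} (hn : (weightHom e q).natDegree < n) :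
    average e D x q = ∑ i ∈ Finset.range n, weightProj e i (D x (weightProj e i q)) :=
  gather_apply e _ hn

theorem average_weightProj {e : W →ₗ[A] W} (he : ∀ y, e (e y) = e y)
    (D : L →ₗ[A] (SymmetricAlgebra A W →+ SymmetricAlgebra A W)) (x : L) (i : ℕ)
    (q : SymmetricAlgebra A W) :
    average e D x (weightProj e i q) = weightProj e i (average e D x q) := by
  have h := Nat.lt_succ_self (weightHom e q).natDegree
  have h1 : average e D x (weightProj e i q) = weightProj e i (D x (weightProj e i q)) :=
    gather_weightProj he _ i q
  rw [h1, average_apply e D x h, map_sum]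
  simp only [weightProj_weightProj he, Finset.sum_ite_eq, Finset.mem_range]
  split_ifs with hi
  · rfl
  · rw [weightProj_eq_zero_of_natDegree_lt (i := i) (q := q) (e := e) (by omega)]
    simp

/-- The projections are `A`-linear and sum to the identity, so the derivation terms of the diagonal
blocks add up to the original derivation term. -/
theorem average_isConnection [LieRingModule L A] {e : W →ₗ[A] W} (he : ∀ y, e (e y) = e y) {t : L →ₗ[A] L}
    {D : L →ₗ[A] (SymmetricAlgebra A W →+ SymmetricAlgebra A W)} (h : IsConnection t D) :
    IsConnection t (average e D) := by
  intro x a q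
  obtain ⟨N, hN, hN'⟩ : ∃ N, (weightHom e (a • q)).natDegree < N ∧ (weightHom e q).natDegree < N :=
    ⟨max ((weightHom e (a • q)).natDegree + 1) ((weightHom e q).natDegree + 1), by omega, by omega⟩
  have h1 : ⁅t x, a⁆ • q = ∑ i ∈ Finset.range N, ⁅t x, a⁆ • weightProj e i q := by
    rw [← Finset.smul_sum, sum_weightProj e hN']
  rw [average_apply e D x hN, average_apply e D x hN', h1, Finset.smul_sum,
    ← Finset.sum_add_distrib]
  simp only [map_smul, h x, map_add, weightProj_self he]

theorem average_mem_degreeLT {e : W →ₗ[A] W}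
    {D : L →ₗ[A] (SymmetricAlgebra A W →+ SymmetricAlgebra A W)} {n : ℕ}
    (h : ∀ x, ∀ q ∈ degreeLT A W n, D x q ∈ degreeLT A W n) (x : L) {q : SymmetricAlgebra A W}
    (hq : q ∈ degreeLT A W n) : average e D x q ∈ degreeLT A W n := by
  rw [average_apply e D x (Nat.lt_succ_self _)]
  exact Submodule.sum_mem _ fun i _ =>
    weightProj_mem_degreeLT_of_mem e i (h x _ (weightProj_mem_degreeLT_of_mem e i hq))

theorem exists_graded_connection [LieRingModule L A] [LieRinehartRing A L] [Module.Projective A W] {e : W →ₗ[A] W}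
    (he : ∀ y, e (e y) = e y) :
    ∃ D : L →ₗ[A] (SymmetricAlgebra A W →+ SymmetricAlgebra A W),
      IsConnection LinearMap.id D ∧
      (∀ x i q, D x (weightProj e i q) = weightProj e i (D x q)) ∧
      ∀ n x, ∀ q ∈ degreeLT A W n, D x q ∈ degreeLT A W n := by
  obtain ⟨D, hD⟩ := exists_connection (A := A) (L := L) (SymmetricAlgebra A W)
  -- Averaging over the total degree makes the filtration stable; averaging next over the weight for
  -- `e` keeps that stability, since the weight projections preserve the filtration.
  refine ⟨average e (average LinearMap.id D),
    average_isConnection he (average_isConnection (fun _ => rfl) hD),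
    fun x i q => average_weightProj he _ x i q, fun n x q hq => average_mem_degreeLT ?_ x hq⟩
  intro x q hq
  refine mem_degreeLT.2 fun m hm => ?_
  rw [← average_weightProj (fun _ => rfl), mem_degreeLT.1 hq m hm, map_zero]

end Average

/-! ### The symmetrization map -/

section Symmetrization

variable {A L W M : Type*} [CommRing A] [LieRing L] [Module A L] [LieRingModule L A]
  [AddCommGroup W] [Module A W] [AddCommGroup M] [Module A M]
  {t : W →ₗ[A] L} {D : W →ₗ[A] (SymmetricAlgebra A W →+ SymmetricAlgebra A W)}
  {T : W →ₗ[A] (M →+ M)}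

theorem mem_of_nsmul_mem (hA : ∀ n : ℕ, n ≠ 0 → IsUnit (n : A)) {N : Submodule A M} {n : ℕ}
    (hn : n ≠ 0) {m : M} (h : n • m ∈ N) : m ∈ N := by
  obtain ⟨u, hu⟩ := hA n hn
  have h1 := N.smul_mem (↑u⁻¹ : A) h
  rwa [← Nat.cast_smul_eq_nsmul A, ← hu, smul_smul, Units.inv_mul, one_smul] at h1

/-- The map `p ⊗ w ↦ T w (φ p) - φ (D w p)`, which is linear because the derivation terms of
the two connections cancel. -/
noncomputable def covariantDiff (hD : IsConnection t D) (hT : IsConnection t T)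
    (φ : SymmetricAlgebra A W →ₗ[A] M) : SymmetricAlgebra A W ⊗[A] W →ₗ[A] M :=
  TensorProduct.lift (LinearMap.mk₂ A (fun p w => T w (φ p) - φ (D w p))
    (fun p q w => by simp only [map_add]; abel)
    (fun a p w => by
      simp only [map_smul, hD w, hT w, map_add, smul_sub]; abel)
    (fun p v w => by simp only [map_add, AddMonoidHom.add_apply]; abel)
    (fun a p w => by simp only [map_smul, AddMonoidHom.smul_apply, smul_sub]))

theorem covariantDiff_tmul (hD : IsConnection t D) (hT : IsConnection t T)
    (φ : SymmetricAlgebra A W →ₗ[A] M) (p : SymmetricAlgebra A W) (w : W) :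
    covariantDiff hD hT φ (p ⊗ₜ w) = T w (φ p) - φ (D w p) := by
  simp [covariantDiff]

/-- Existence of the symmetrization map: a linear map on `S(W)` with prescribed values in weight
zero that intertwines the operators `T` with the multiplication of `S(W)`, up to terms
of lower degree and on average over the factors of a product. -/
theorem exists_symmetrization (hA : ∀ n : ℕ, n ≠ 0 → IsUnit (n : A)) {e : W →ₗ[A] W}
    (he : ∀ y, e (e y) = e y) (hD : IsConnection t D) (hT : IsConnection t T)
    (hDe : ∀ w i q, D w (weightProj e i q) = weightProj e i (D w q))
    (f : SymmetricAlgebra A W →ₗ[A] M) :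
    ∃ φ : SymmetricAlgebra A W →ₗ[A] M,
      (∀ q, φ (weightProj e 0 q) = f (weightProj e 0 q)) ∧
      ∀ i q, covariantDiff hD hT φ (diff e (weightProj e i q)) = i • φ (weightProj e i q) := by
  -- `F i` is the map on weight `i`. The required identity in weight `i + 1` involves only the
  -- values in weight `i`, so dividing it by `i + 1` is the definition.
  let F : ℕ → SymmetricAlgebra A W →ₗ[A] M := fun n => Nat.rec (f ∘ₗ weightProj e 0)
    (fun i g => Ring.inverse ((i + 1 : ℕ) : A) •
      (covariantDiff hD hT g ∘ₗ diff e ∘ₗ weightProj e (i + 1))) n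
  have F0 : F 0 = f ∘ₗ weightProj e 0 := rfl
  have FS : ∀ i, F (i + 1) = Ring.inverse ((i + 1 : ℕ) : A) •
      (covariantDiff hD hT (F i) ∘ₗ diff e ∘ₗ weightProj e (i + 1)) := fun i => rfl
  have Fproj : ∀ i q, F i (weightProj e i q) = F i q := by
    intro i q
    cases i with
    | zero => simp only [F0, LinearMap.comp_apply, weightProj_self he]
    | succ i => simp only [FS, LinearMap.comp_apply, LinearMap.smul_apply, weightProj_self he]
  have hg : ∀ i q, gatherLinear e F (weightProj e i q) = F i q := fun i q => by
    rw [gatherLinear_weightProj he, Fproj]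
  refine ⟨gatherLinear e F, fun q => ?_, fun i q => ?_⟩
  · rw [hg, F0]; rfl
  · cases i with
    | zero => simp [diff_weightProj_zero he]
    | succ i =>
      have h1 : (i + 1) • F (i + 1) q =
          covariantDiff hD hT (F i) (diff e (weightProj e (i + 1) q)) := by
        rw [FS, LinearMap.smul_apply, ← Nat.cast_smul_eq_nsmul A, smul_smul,
          Ring.mul_inverse_cancel _ (hA _ (Nat.succ_ne_zero i)), one_smul]
        rfl
      rw [hg, h1, diff_weightProj_succ he]
      induction diff e q with
      | zero => simp
      | add p q hp hq => simp only [map_add, hp, hq]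
      | tmul p w =>
        -- As `D w` preserves the weight, the glued map may be replaced by `F i` in both terms.
        rw [LinearMap.rTensor_tmul, covariantDiff_tmul, covariantDiff_tmul, hDe, hg, hg, Fproj,
          Fproj]

variable {φ : SymmetricAlgebra A W →ₗ[A] M}

/-- The identity for `φ` at `e w * q`, with `q` of weight `i`, gives `(i + 1) • φ (e w * q)` as `T w
(φ q)`, plus a sum in which another factor of `q` acts first, plus lower terms. By induction and the
commutation rule, `T w` can be moved to the front of that sum, which then becomes `i • T w (φ q)`.
Division by `i + 1` concludes. -/
theorem symmetrization_sub_mem (hA : ∀ n : ℕ, n ≠ 0 → IsUnit (n : A)) {e : W →ₗ[A] W}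
    (he : ∀ y, e (e y) = e y) (hD : IsConnection t D) (hT : IsConnection t T)
    (hDn : ∀ n w, ∀ q ∈ degreeLT A W n, D w q ∈ degreeLT A W n)
    (hTe : ∀ w, T (e w) = T w)
    (hTlie : ∀ v w, ∃ z, ∀ m, T v (T w m) = T w (T v m) + T z m)
    (hφ : ∀ i q, covariantDiff hD hT φ (diff e (weightProj e i q)) = i • φ (weightProj e i q))
    (n : ℕ) (w : W) {q : SymmetricAlgebra A W} (hq : q ∈ degreeLT A W n) :
    T w (φ q) - φ (ι A W (e w) * q) ∈ (degreeLT A W n).map φ := by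
  induction n generalizing q w with
  | zero => simp [eq_zero_of_mem_degreeLT_zero hq]
  | succ n ih =>
    have step : ∀ w, ∀ m ∈ (degreeLT A W n).map φ, T w m ∈ (degreeLT A W (n + 1)).map φ := by
      rintro w _ ⟨p, hp, rfl⟩
      have h := Submodule.map_mono (f := φ) (degreeLT_mono (Nat.le_succ n)) (ih w hp)
      have h' : φ (ι A W (e w) * p) ∈ (degreeLT A W (n + 1)).map φ :=
        Submodule.mem_map_of_mem (ι_mul_mem_degreeLT _ hp)
      simpa using add_mem h h'
    refine induction_weight (motive := fun q => T w (φ q) - φ (ι A W (e w) * q) ∈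
      (degreeLT A W (n + 1)).map φ) e q (by simp) (fun p q hp hq => ?_) fun i => ?_
    · rw [map_add, map_add, mul_add, map_add, add_sub_add_comm]
      exact add_mem hp hq
    have hq' := weightProj_mem_degreeLT_of_mem e i hq
    -- Moving `T w` past the operator of another factor costs a term `T z`, which stays within the
    -- allowed degree.
    have hd : covariantDiff hD hT φ ((LinearMap.mulLeft A (ι A W (e w))).rTensor W
        (diff e (weightProj e i q))) - T w (covariantDiff hD hT φ (diff e (weightProj e i q))) ∈
        (degreeLT A W (n + 1)).map φ := by
      refine diff_induction (motive := fun s => covariantDiff hD hT φ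
        ((LinearMap.mulLeft A (ι A W (e w))).rTensor W s) - T w (covariantDiff hD hT φ s) ∈
          (degreeLT A W (n + 1)).map φ) hq' (by simp) (fun s t hs ht => ?_) fun p v hp => ?_
      · simp only [map_add, add_sub_add_comm]
        exact add_mem hs ht
      · obtain ⟨z, hz⟩ := hTlie v w
        rw [LinearMap.rTensor_tmul, covariantDiff_tmul, covariantDiff_tmul,
          LinearMap.mulLeft_apply]
        have h1 := step v _ (ih w hp)
        have h2 := step w _ (Submodule.mem_map_of_mem (f := φ) (hDn n v p hp))
        have h3 := step z _ (Submodule.mem_map_of_mem (f := φ) hp)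
        have h4 := Submodule.mem_map_of_mem (f := φ)
          (hDn (n + 1) v _ (ι_mul_mem_degreeLT (e w) hp))
        rw [map_sub, hz] at h1
        have h5 := add_mem (sub_mem (sub_mem h3 h1) h4) h2
        rw [map_sub]
        convert h5 using 1
        abel
    -- The factor `e w` has pure weight one, so the product has pure weight `i + 1`.
    have hi : weightProj e (i + 1) (ι A W (e w) * weightProj e i q) =
        ι A W (e w) * weightProj e i q := by
      rw [weightProj_succ_ι_mul, he, sub_self, map_zero, zero_mul, zero_add, weightProj_self he]
    have h1 := hφ (i + 1) (ι A W (e w) * weightProj e i q)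
    rw [hi, diff_ι_mul, map_add, covariantDiff_tmul, he, hTe] at h1
    have h2 := Submodule.mem_map_of_mem (f := φ) (hDn (n + 1) (e w) _ hq')
    rw [hφ, map_nsmul] at hd
    refine mem_of_nsmul_mem hA (Nat.succ_ne_zero i) ?_
    have h3 := sub_mem h2 hd
    rw [Nat.succ_eq_add_one, smul_sub, ← h1, add_smul, one_smul]
    convert h3 using 1
    abel

/-- Stability of the range is what later gives surjectivity: the range contains generators of the
module. -/
theorem apply_mem_range_symmetrization (hA : ∀ n : ℕ, n ≠ 0 → IsUnit (n : A)) {e : W →ₗ[A] W}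
    (he : ∀ y, e (e y) = e y) (hD : IsConnection t D) (hT : IsConnection t T)
    (hDn : ∀ n w, ∀ q ∈ degreeLT A W n, D w q ∈ degreeLT A W n)
    (hTe : ∀ w, T (e w) = T w)
    (hTlie : ∀ v w, ∃ z, ∀ m, T v (T w m) = T w (T v m) + T z m)
    (hφ : ∀ i q, covariantDiff hD hT φ (diff e (weightProj e i q)) = i • φ (weightProj e i q))
    (w : W) {m : M} (hm : m ∈ LinearMap.range φ) : T w m ∈ LinearMap.range φ := by
  obtain ⟨q, rfl⟩ := hm
  obtain ⟨n, hn⟩ := exists_mem_degreeLT q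
  have h := LinearMap.map_le_range
    (symmetrization_sub_mem hA he hD hT hDn hTe hTlie hφ n w hn)
  simpa using add_mem h (LinearMap.mem_range_self φ (ι A W (e w) * q))

/-- Applied to a symmetrization map, a morphism to a module on which `L` acts by multiplication
up to terms of lower degree gives the identity up to terms of lower degree. -/
theorem symmetrization_symbol (hA : ∀ n : ℕ, n ≠ 0 → IsUnit (n : A)) {e : W →ₗ[A] W}
    (he : ∀ y, e (e y) = e y) (hD : IsConnection t D) (hT : IsConnection t T)
    (hDn : ∀ n w, ∀ q ∈ degreeLT A W n, D w q ∈ degreeLT A W n)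
    (hφ : ∀ i q, covariantDiff hD hT φ (diff e (weightProj e i q)) = i • φ (weightProj e i q))
    {ρ : L → SymmetricAlgebra A L →+ SymmetricAlgebra A L}
    (hρ : ∀ n x, ∀ r ∈ degreeLT A L n, ρ x r - ι A L x * r ∈ degreeLT A L n)
    (Ψ : M →+ SymmetricAlgebra A L) (hΨ : ∀ w m, Ψ (T w m) = ρ (t w) (Ψ m))
    {f : W →ₗ[A] L} (hf : ∀ w, f (e w) = t w)
    (h0 : ∀ n, ∀ q ∈ degreeLT A W (n + 1),
      Ψ (φ (weightProj e 0 q)) - mapHom f (weightProj e 0 q) ∈ degreeLT A L n)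
    (n : ℕ) {q : SymmetricAlgebra A W} (hq : q ∈ degreeLT A W (n + 1)) :
    Ψ (φ q) - mapHom f q ∈ degreeLT A L n := by
  -- Both `φ` and the identity satisfy an Euler identity in weight `i`, so for `i > 0` they can be
  -- compared after one derivation, on tensors `p ⊗ v` with `p` of smaller degree.
  have red : ∀ n, (∀ p v, p ∈ degreeLT A W n → Ψ (covariantDiff hD hT φ (p ⊗ₜ v)) -
      mapHom f (contract e (p ⊗ₜ v)) ∈ degreeLT A L n) →
      ∀ q ∈ degreeLT A W (n + 1), Ψ (φ q) - mapHom f q ∈ degreeLT A L n := by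
    intro n hn q hq
    refine induction_weight (motive := fun q => Ψ (φ q) - mapHom f q ∈ degreeLT A L n) e q
      (by simp) (fun p q hp hq => ?_) fun i => ?_
    · simp only [map_add, add_sub_add_comm]
      exact add_mem hp hq
    rcases Nat.eq_zero_or_pos i with rfl | hi
    · exact h0 n q hq
    have hd : Ψ (covariantDiff hD hT φ (diff e (weightProj e i q))) -
        mapHom f (contract e (diff e (weightProj e i q))) ∈ degreeLT A L n := by
      refine diff_induction (motive := fun s => Ψ (covariantDiff hD hT φ s) -
        mapHom f (contract e s) ∈ degreeLT A L n) (weightProj_mem_degreeLT_of_mem e i hq) (by simp)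
        (fun s t hs ht => ?_) hn
      simp only [map_add, add_sub_add_comm]
      exact add_mem hs ht
    rw [hφ, contract_diff_weightProj he, map_nsmul, map_nsmul, ← smul_sub] at hd
    exact mem_of_nsmul_mem hA hi.ne' hd
  induction n generalizing q with
  | zero =>
    refine red 0 (fun p v hp => ?_) q hq
    simp [eq_zero_of_mem_degreeLT_zero hp]
  | succ n ih =>
    refine red (n + 1) (fun p v hp => ?_) q hq
    rw [covariantDiff_tmul, contract_tmul, map_mul, mapHom_ι, hf, map_sub, hΨ]
    have h1 := ih hp
    have h2 := mapHom_mem_degreeLT f hp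
    have h3 : Ψ (φ p) ∈ degreeLT A L (n + 1) := by
      simpa using add_mem (degreeLT_mono (Nat.le_succ n) h1) h2
    have h4 := hρ (n + 1) (t v) _ h3
    have h5 := ι_mul_mem_degreeLT (t v) h1
    have hDp := hDn _ v p hp
    have h6 : Ψ (φ (D v p)) ∈ degreeLT A L (n + 1) := by
      simpa using add_mem (degreeLT_mono (Nat.le_succ n) (ih hDp)) (mapHom_mem_degreeLT f hDp)
    have h7 := sub_mem (add_mem h4 h5) h6
    convert h7 using 1
    ring

end Symmetrization

/-! ### Perturbing a connection towards flatness -/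

section DivSucc

variable {A L : Type*} [CommRing A] [AddCommGroup L] [Module A L]

/-- Division of the component of degree `i` by `i + 1`. -/
noncomputable def divSucc : SymmetricAlgebra A L →ₗ[A] SymmetricAlgebra A L :=
  gatherLinear LinearMap.id fun i => Ring.inverse ((i + 1 : ℕ) : A) • LinearMap.id

theorem divSucc_mem_degreeLT {n : ℕ} {q : SymmetricAlgebra A L} (hq : q ∈ degreeLT A L n) :
    divSucc q ∈ degreeLT A L n := by
  rw [divSucc, gatherLinear_apply _ _ (Nat.lt_succ_self _)]
  exact Submodule.sum_mem _ fun i _ =>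
    Submodule.smul_mem _ _ (weightProj_mem_degreeLT_of_mem _ i hq)

end DivSucc

section FlatConnection

variable {A L : Type*} [CommRing A] [LieRing L] [Module A L]

section Perturbation

variable (C : L →ₗ[A] (SymmetricAlgebra A L →+ SymmetricAlgebra A L))
  (D : L →ₗ[A] (SymmetricAlgebra A L →ₗ[A] SymmetricAlgebra A L))

/-- The connection `C` perturbed by the tensor `D`. -/
def perturb : L →ₗ[A] (SymmetricAlgebra A L →+ SymmetricAlgebra A L) where
  toFun x := C x + (D x).toAddMonoidHom
  map_add' x y := by ext q; simp [add_add_add_comm]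
  map_smul' a x := by ext q; simp

theorem perturb_apply (x : L) (q : SymmetricAlgebra A L) : perturb C D x q = C x q + D x q := rfl

variable {C} in
theorem perturb_isConnection [LieRingModule L A] (hC : IsConnection LinearMap.id C) :
    IsConnection LinearMap.id (perturb C D) := fun x a q => by
  simp only [perturb_apply, hC x, map_smul, smul_add]
  abel

/-- The obstruction to the flatness of `perturb C D`, arranged in such a way that its value at an
element of degree `n` involves `D` in degrees at most `n` only. -/
def obstruction (x y : L) (p : SymmetricAlgebra A L) : SymmetricAlgebra A L :=
  perturb C D ⁅x, y⁆ p - perturb C D x (perturb C D y p - ι A L y * p) +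
    perturb C D y (perturb C D x p - ι A L x * p) - C x (ι A L y * p) + C y (ι A L x * p)

theorem obstruction_swap (x y : L) (p : SymmetricAlgebra A L) :
    obstruction C D y x p = -obstruction C D x y p := by
  unfold obstruction
  rw [← lie_skew x y, map_neg, AddMonoidHom.neg_apply]
  abel

theorem obstruction_add (x y : L) (p q : SymmetricAlgebra A L) :
    obstruction C D x y (p + q) = obstruction C D x y p + obstruction C D x y q := by
  simp only [obstruction, map_add, mul_add, map_sub]
  abel

theorem obstruction_add_right (x y z : L) (p : SymmetricAlgebra A L) :
    obstruction C D x (y + z) p = obstruction C D x y p + obstruction C D x z p := by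
  simp only [obstruction, map_add, add_mul, map_sub, lie_add, AddMonoidHom.add_apply]
  abel

variable {C} [LieRingModule L A]

/-- The curvature is tensorial: first derivatives of `a` cancel in pairs, and second derivatives
cancel because the anchor is a Lie morphism. -/
theorem obstruction_smul (hC : IsConnection LinearMap.id C) (a : A) (x y : L)
    (p : SymmetricAlgebra A L) :
    obstruction C D x y (a • p) = a • obstruction C D x y p := by
  have h := perturb_isConnection D hC
  have hl : ⁅⁅x, y⁆, a⁆ = ⁅x, ⁅y, a⁆⁆ - ⁅y, ⁅x, a⁆⁆ := lie_lie x y a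
  simp only [obstruction, mul_smul_comm, hC _ a, h _ a, map_sub, map_add, h _ ⁅y, a⁆, h _ ⁅x, a⁆,
    LinearMap.id_apply, hl]
  module

variable [LieRinehartRing A L]

theorem obstruction_smul_right (hC : IsConnection LinearMap.id C) (a : A) (x y : L)
    (p : SymmetricAlgebra A L) :
    obstruction C D x (a • y) p = a • obstruction C D x y p := by
  have h := perturb_isConnection D hC
  simp only [obstruction, map_smul, smul_mul_assoc, hC _ a, h _ a, map_sub, map_add,
    LieRinehartRing.leibniz_smul_right, LinearMap.id_apply, AddMonoidHom.add_apply,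
    AddMonoidHom.smul_apply]
  module

/-- The obstruction as a trilinear map. -/
def obstructionLinear (hC : IsConnection LinearMap.id C) :
    L →ₗ[A] L →ₗ[A] SymmetricAlgebra A L →ₗ[A] SymmetricAlgebra A L :=
  LinearMap.mk₂ A (fun x y =>
      { toFun := obstruction C D x y
        map_add' := obstruction_add C D x y
        map_smul' := fun a p => obstruction_smul D hC a x y p })
    (fun x y z => by
      ext p
      change obstruction C D (x + y) z p = obstruction C D x z p + obstruction C D y z p
      rw [obstruction_swap, obstruction_add_right, obstruction_swap C D x, obstruction_swap C D y]
      abel)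
    (fun a x y => by
      ext p
      change obstruction C D (a • x) y p = a • obstruction C D x y p
      rw [obstruction_swap, obstruction_smul_right D hC, obstruction_swap C D x, smul_neg,
        neg_neg])
    (fun x y z => by ext p; exact obstruction_add_right C D x y z p)
    (fun a x y => by ext p; exact obstruction_smul_right D hC a x y p)

theorem obstructionLinear_apply (hC : IsConnection LinearMap.id C) (x y : L)
    (p : SymmetricAlgebra A L) : obstructionLinear D hC x y p = obstruction C D x y p := rfl

/-- The contraction `p ⊗ y ↦ obstruction C D x y p`. -/
noncomputable def contractObstruction (hC : IsConnection LinearMap.id C) (x : L) :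
    SymmetricAlgebra A L ⊗[A] L →ₗ[A] SymmetricAlgebra A L :=
  TensorProduct.lift (obstructionLinear D hC x).flip

@[simp]
theorem contractObstruction_tmul (hC : IsConnection LinearMap.id C) (x y : L)
    (p : SymmetricAlgebra A L) :
    contractObstruction D hC x (p ⊗ₜ y) = obstruction C D x y p := rfl

/-- One step of the iteration that kills the obstruction. -/
noncomputable def improve (hC : IsConnection LinearMap.id C) :
    L →ₗ[A] (SymmetricAlgebra A L →ₗ[A] SymmetricAlgebra A L) where
  toFun x := LinearMap.mulLeft A (ι A L x) +
    contractObstruction D hC x ∘ₗ diff LinearMap.id ∘ₗ divSucc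
  map_add' x y := by
    ext p
    simp only [LinearMap.add_apply, LinearMap.comp_apply, LinearMap.mulLeft_apply, map_add, add_mul]
    rw [add_add_add_comm]
    congr 1
    induction diff LinearMap.id (divSucc p) with
    | zero => simp
    | add s t hs ht => simp only [map_add, hs, ht]; abel
    | tmul q z =>
      simp only [contractObstruction_tmul, ← obstructionLinear_apply D hC, map_add,
        LinearMap.add_apply]
  map_smul' a x := by
    ext p
    simp only [LinearMap.add_apply, LinearMap.smul_apply, LinearMap.comp_apply,
      LinearMap.mulLeft_apply, map_smul, smul_mul_assoc, smul_add, RingHom.id_apply]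
    congr 1
    induction diff LinearMap.id (divSucc p) with
    | zero => simp
    | add s t hs ht => simp only [map_add, hs, ht, smul_add]
    | tmul q z =>
      simp only [contractObstruction_tmul, ← obstructionLinear_apply D hC, map_smul,
        LinearMap.smul_apply]

theorem improve_apply (hC : IsConnection LinearMap.id C) (x : L) (p : SymmetricAlgebra A L) :
    improve D hC x p = ι A L x * p + contractObstruction D hC x (diff LinearMap.id (divSucc p)) :=
  rfl

end Perturbation

end FlatConnection

/-! ### Convergence of the iteration in the degree filtration -/

section Iteration

variable {A L : Type*} [CommRing A] [LieRing L] [Module A L]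
  {C : L →ₗ[A] (SymmetricAlgebra A L →+ SymmetricAlgebra A L)}
  {D D' : L →ₗ[A] (SymmetricAlgebra A L →ₗ[A] SymmetricAlgebra A L)}

/-- The operators `D x` coincide with the multiplication by `x` up to terms of lower degree. -/
def IsLeadingMul (D : L →ₗ[A] (SymmetricAlgebra A L →ₗ[A] SymmetricAlgebra A L)) : Prop :=
  ∀ n x, ∀ q ∈ degreeLT A L n, D x q - ι A L x * q ∈ degreeLT A L n

theorem perturb_sub_mem (hCn : ∀ n x, ∀ q ∈ degreeLT A L n, C x q ∈ degreeLT A L n)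
    (hD : IsLeadingMul D) (n : ℕ) (x : L) (q : SymmetricAlgebra A L) (hq : q ∈ degreeLT A L n) :
    perturb C D x q - ι A L x * q ∈ degreeLT A L n := by
  rw [perturb_apply, add_sub_assoc]
  exact add_mem (hCn n x q hq) (hD n x q hq)

theorem perturb_mem (hCn : ∀ n x, ∀ q ∈ degreeLT A L n, C x q ∈ degreeLT A L n)
    (hD : IsLeadingMul D) (n : ℕ) (x : L) (q : SymmetricAlgebra A L) (hq : q ∈ degreeLT A L n) :
    perturb C D x q ∈ degreeLT A L (n + 1) := by
  simpa using add_mem (degreeLT_mono (Nat.le_succ n) (perturb_sub_mem hCn hD n x q hq))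
    (ι_mul_mem_degreeLT x hq)

theorem obstruction_mem (hCn : ∀ n x, ∀ q ∈ degreeLT A L n, C x q ∈ degreeLT A L n)
    (hD : IsLeadingMul D) (n : ℕ) (x y : L) (q : SymmetricAlgebra A L) (hq : q ∈ degreeLT A L n) :
    obstruction C D x y q ∈ degreeLT A L (n + 1) :=
  add_mem (sub_mem (add_mem (sub_mem (perturb_mem hCn hD n _ q hq)
    (perturb_mem hCn hD n _ _ (perturb_sub_mem hCn hD n y q hq)))
    (perturb_mem hCn hD n _ _ (perturb_sub_mem hCn hD n x q hq)))
    (hCn _ x _ (ι_mul_mem_degreeLT y hq))) (hCn _ y _ (ι_mul_mem_degreeLT x hq))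

/-- The operators are applied only to `q` and to differences such as `perturb C D y q - ι A L y *
q`, which have no larger degree than `q`. -/
theorem obstruction_congr (hCn : ∀ n x, ∀ q ∈ degreeLT A L n, C x q ∈ degreeLT A L n)
    (hD : IsLeadingMul D) {n : ℕ} (h : ∀ x, ∀ q ∈ degreeLT A L n, D x q = D' x q) (x y : L)
    {q : SymmetricAlgebra A L} (hq : q ∈ degreeLT A L n) :
    obstruction C D x y q = obstruction C D' x y q := by
  have h' : ∀ x, ∀ q ∈ degreeLT A L n, perturb C D x q = perturb C D' x q := fun x q hq => by
    rw [perturb_apply, perturb_apply, h x q hq]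
  rw [obstruction, obstruction, h' x _ (perturb_sub_mem hCn hD n y q hq),
    h' y _ (perturb_sub_mem hCn hD n x q hq), h' _ q hq, h' _ q hq, h' _ q hq]

variable [LieRingModule L A] [LieRinehartRing A L]

/-- The obstruction raises the degree by at most one, and the derivation before it lowers the degree
by one. -/
theorem improve_isLeadingMul (hC : IsConnection LinearMap.id C)
    (hCn : ∀ n x, ∀ q ∈ degreeLT A L n, C x q ∈ degreeLT A L n)
    (hD : IsLeadingMul D) : IsLeadingMul (improve D hC) := by
  intro n x q hq
  rw [improve_apply, add_sub_cancel_left]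
  cases n with
  | zero => simp [eq_zero_of_mem_degreeLT_zero hq]
  | succ n =>
    refine diff_induction (motive := fun s => contractObstruction D hC x s ∈ degreeLT A L (n + 1))
      (divSucc_mem_degreeLT hq) (by simp) (fun s t hs ht => ?_) fun p y hp => ?_
    · rw [map_add]; exact add_mem hs ht
    · exact obstruction_mem hCn hD n x y p hp

/-- Contraction property: agreement in degrees below `n` improves to agreement below `n + 1`, so the
iteration stabilizes in each degree and its limit is a fixed point. -/
theorem improve_congr (hC : IsConnection LinearMap.id C)
    (hCn : ∀ n x, ∀ q ∈ degreeLT A L n, C x q ∈ degreeLT A L n)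
    (hD : IsLeadingMul D) {n : ℕ} (h : ∀ x, ∀ q ∈ degreeLT A L n, D x q = D' x q) (x : L)
    (q : SymmetricAlgebra A L) (hq : q ∈ degreeLT A L (n + 1)) :
    improve D hC x q = improve D' hC x q := by
  rw [improve_apply, improve_apply]
  congr 1
  refine diff_induction (motive := fun s => contractObstruction D hC x s =
    contractObstruction D' hC x s) (divSucc_mem_degreeLT hq) (by simp) (fun s t hs ht => ?_)
    fun p y hp => ?_
  · rw [map_add, map_add, hs, ht]
  · exact obstruction_congr hCn hD h x y hp

/-- The iteration starting at the multiplication. -/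
noncomputable def improveIter (hC : IsConnection LinearMap.id C) :
    ℕ → L →ₗ[A] (SymmetricAlgebra A L →ₗ[A] SymmetricAlgebra A L)
  | 0 => LinearMap.mul A (SymmetricAlgebra A L) ∘ₗ ι A L
  | n + 1 => improve (improveIter hC n) hC

theorem improveIter_isLeadingMul (hC : IsConnection LinearMap.id C)
    (hCn : ∀ n x, ∀ q ∈ degreeLT A L n, C x q ∈ degreeLT A L n) (n : ℕ) :
    IsLeadingMul (improveIter hC n) := by
  induction n with
  | zero => intro n x q hq; simp [improveIter]
  | succ n ih => exact improve_isLeadingMul hC hCn ih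

theorem improveIter_succ_eq (hC : IsConnection LinearMap.id C)
    (hCn : ∀ n x, ∀ q ∈ degreeLT A L n, C x q ∈ degreeLT A L n) (n : ℕ) (x : L)
    (q : SymmetricAlgebra A L) (hq : q ∈ degreeLT A L n) :
    improveIter hC (n + 1) x q = improveIter hC n x q := by
  induction n generalizing x q with
  | zero => simp [eq_zero_of_mem_degreeLT_zero hq]
  | succ n ih =>
    exact improve_congr hC hCn (improveIter_isLeadingMul hC hCn (n + 1)) ih x q hq

theorem improveIter_eq_of_le (hC : IsConnection LinearMap.id C)
    (hCn : ∀ n x, ∀ q ∈ degreeLT A L n, C x q ∈ degreeLT A L n) {m n : ℕ} (h : n ≤ m) (x : L)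
    (q : SymmetricAlgebra A L) (hq : q ∈ degreeLT A L n) :
    improveIter hC m x q = improveIter hC n x q := by
  induction m, h using Nat.le_induction with
  | base => rfl
  | succ m hm ih => rw [improveIter_succ_eq hC hCn m x q (degreeLT_mono hm hq), ih]

/-- The limit of the iteration. -/
noncomputable def improveLimit (hC : IsConnection LinearMap.id C) :
    L →ₗ[A] (SymmetricAlgebra A L →ₗ[A] SymmetricAlgebra A L) where
  -- Degree `i` lies in `degreeLT A L (i + 1)`, where the iteration is constant from step `i + 1`
  -- on.
  toFun x := gatherLinear LinearMap.id fun i => improveIter hC (i + 1) x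
  map_add' x y := by
    ext q
    rw [LinearMap.add_apply]
    simp only [gatherLinear_apply _ _ (Nat.lt_succ_self (weightHom LinearMap.id q).natDegree)]
    simp [Finset.sum_add_distrib]
  map_smul' a x := by
    ext q
    rw [LinearMap.smul_apply]
    simp only [gatherLinear_apply _ _ (Nat.lt_succ_self (weightHom LinearMap.id q).natDegree)]
    simp [Finset.smul_sum]

theorem improveLimit_eq (hC : IsConnection LinearMap.id C)
    (hCn : ∀ n x, ∀ q ∈ degreeLT A L n, C x q ∈ degreeLT A L n) (n : ℕ) (x : L)
    (q : SymmetricAlgebra A L) (hq : q ∈ degreeLT A L n) :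
    improveLimit hC x q = improveIter hC n x q := by
  rw [← sum_weightProj_of_mem_degreeLT hq, map_sum, map_sum]
  refine Finset.sum_congr rfl fun i hi => ?_
  rw [Finset.mem_range] at hi
  rw [improveIter_eq_of_le hC hCn (show i + 1 ≤ n from hi) x _
    (weightProj_mem_degreeLT i (i + 1) (Nat.lt_succ_self i) q)]
  exact gatherLinear_weightProj (fun _ => rfl) _ i q

theorem improveLimit_isLeadingMul (hC : IsConnection LinearMap.id C)
    (hCn : ∀ n x, ∀ q ∈ degreeLT A L n, C x q ∈ degreeLT A L n) :
    IsLeadingMul (improveLimit hC) := fun n x q hq => by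
  rw [improveLimit_eq hC hCn n x q hq]
  exact improveIter_isLeadingMul hC hCn n n x q hq

theorem improve_improveLimit (hC : IsConnection LinearMap.id C)
    (hCn : ∀ n x, ∀ q ∈ degreeLT A L n, C x q ∈ degreeLT A L n) (x : L)
    (q : SymmetricAlgebra A L) : improve (improveLimit hC) hC x q = improveLimit hC x q := by
  obtain ⟨n, hn⟩ := exists_mem_degreeLT q
  have hn' := degreeLT_mono (Nat.le_succ n) hn
  rw [improveLimit_eq hC hCn (n + 1) x q hn',
    improve_congr hC hCn (improveLimit_isLeadingMul hC hCn) (improveLimit_eq hC hCn n) x q hn']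
  rfl

end Iteration

/-! ### Flatness of the fixed point -/

section Flatness

variable {A L : Type*} [CommRing A] [LieRing L] [Module A L]
  {C : L →ₗ[A] (SymmetricAlgebra A L →+ SymmetricAlgebra A L)}
  {D : L →ₗ[A] (SymmetricAlgebra A L →ₗ[A] SymmetricAlgebra A L)}

/-- The curvature of the family of operators `E` vanishes at `q`. -/
def IsFlatAt (E : L →ₗ[A] (SymmetricAlgebra A L →+ SymmetricAlgebra A L))
    (q : SymmetricAlgebra A L) : Prop :=
  ∀ x y, E x (E y q) - E y (E x q) = E ⁅x, y⁆ q

theorem isFlatAt_perturb_iff {q : SymmetricAlgebra A L} :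
    IsFlatAt (perturb C D) q ↔
      ∀ x y, D x (ι A L y * q) - D y (ι A L x * q) = obstruction C D x y q := by
  refine forall_congr' fun x => forall_congr' fun y => ?_
  have h : ∀ x y, perturb C D x (perturb C D y q - ι A L y * q) =
      perturb C D x (perturb C D y q) - C x (ι A L y * q) - D x (ι A L y * q) := fun x y => by
    rw [map_sub, perturb_apply C D x (ι A L y * q), sub_sub]
  rw [obstruction, h, h]
  constructor <;> intro h1 <;> linear_combination h1

/-- The Bianchi identity. -/
theorem obstruction_cyclic {q : SymmetricAlgebra A L} (hq : IsFlatAt (perturb C D) q)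
    (hq' : ∀ x, IsFlatAt (perturb C D) (perturb C D x q - ι A L x * q)) (x y z : L) :
    obstruction C D x y (ι A L z * q) + obstruction C D y z (ι A L x * q) +
      obstruction C D z x (ι A L y * q) = 0 := by
  set E := perturb C D with hE
  -- This restates flatness at `q`, using that `y * (z * q)` is symmetric in `y` and `z`. Applying
  -- `E x` and summing cyclically gives the identity, with flatness at the remainders and the Jacobi
  -- identity absorbing the rest.
  have hN : ∀ y z, (E y (ι A L z * q) - ι A L y * (ι A L z * q)) -
      (E z (ι A L y * q) - ι A L z * (ι A L y * q)) =
      E ⁅y, z⁆ q - E y (E z q - ι A L z * q) + E z (E y q - ι A L y * q) := by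
    intro y z
    rw [← hq y z, map_sub, map_sub]
    ring
  have h1 : ∀ x y z, E x (E y (ι A L z * q) - ι A L y * (ι A L z * q)) -
      E x (E z (ι A L y * q) - ι A L z * (ι A L y * q)) =
      E x (E ⁅y, z⁆ q) - E x (E y (E z q - ι A L z * q)) + E x (E z (E y q - ι A L y * q)) := by
    intro x y z
    rw [← map_sub, hN, map_add, map_sub]
  have h2 : ∀ x y z : L, E ⁅x, y⁆ (E z q - ι A L z * q) = E ⁅x, y⁆ (E z q) - E ⁅x, y⁆ (ι A L z * q) :=
    fun x y z => map_sub _ _ _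
  have h3 : E ⁅⁅x, y⁆, z⁆ q + E ⁅⁅y, z⁆, x⁆ q + E ⁅⁅z, x⁆, y⁆ q = 0 := by
    have : ⁅⁅x, y⁆, z⁆ + ⁅⁅y, z⁆, x⁆ + ⁅⁅z, x⁆, y⁆ = 0 := by
      have := lie_jacobi z x y
      rw [← lie_skew z ⁅x, y⁆, ← lie_skew x ⁅y, z⁆, ← lie_skew y ⁅z, x⁆, ← neg_add, ← neg_add, neg_eq_zero] at this
      rw [← this]
    rw [← AddMonoidHom.add_apply, ← map_add, ← AddMonoidHom.add_apply, ← map_add, this, map_zero,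
      AddMonoidHom.zero_apply]
  have h4 : ∀ x y z, C x (ι A L y * (ι A L z * q)) = C x (ι A L z * (ι A L y * q)) :=
    fun x y z => by rw [mul_left_comm]
  simp only [obstruction, ← hE]
  linear_combination -h1 x y z - h1 y z x - h1 z x y + hq' z x y + hq' x y z + hq' y z x +
    h2 x y z + h2 y z x + h2 z x y + hq ⁅x, y⁆ z + hq ⁅y, z⁆ x + hq ⁅z, x⁆ y + h3 -
    h4 x y z - h4 y z x - h4 z x y

theorem IsFlatAt.add {E : L →ₗ[A] (SymmetricAlgebra A L →+ SymmetricAlgebra A L)}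
    {p q : SymmetricAlgebra A L} (hp : IsFlatAt E p) (hq : IsFlatAt E q) : IsFlatAt E (p + q) :=
  fun x y => by
    simp only [map_add, ← hp x y, ← hq x y]
    abel

variable [LieRingModule L A] [LieRinehartRing A L]

/-- The fixed point equation in degree `n`, with denominators cleared. -/
theorem nsmul_sub_of_improve_eq (hA : ∀ n : ℕ, n ≠ 0 → IsUnit (n : A))
    (hC : IsConnection LinearMap.id C) (hD : ∀ x q, improve D hC x q = D x q) (n : ℕ) (x : L)
    (q : SymmetricAlgebra A L) :
    (n + 1) • (D x (weightProj LinearMap.id n q) - ι A L x * weightProj LinearMap.id n q) =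
      contractObstruction D hC x (diff LinearMap.id (weightProj LinearMap.id n q)) := by
  have h : divSucc (weightProj LinearMap.id n q) =
      Ring.inverse ((n + 1 : ℕ) : A) • weightProj LinearMap.id n q :=
    gatherLinear_weightProj (fun _ => rfl) _ n q
  rw [← hD, improve_apply, add_sub_cancel_left, h, map_smul, map_smul, ← Nat.cast_smul_eq_nsmul A,
    smul_smul, Ring.mul_inverse_cancel _ (hA _ (Nat.succ_ne_zero n)), one_smul]

/-- Induction on the degree: flatness in lower degrees gives the Bianchi identity, which says that
the obstruction is closed in the Koszul sense. The operator `improve` uses the contracting homotopy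
of that complex, so its fixed points solve the flatness equation in the next degree. -/
theorem isFlatAt_of_improve_eq (hA : ∀ n : ℕ, n ≠ 0 → IsUnit (n : A))
    (hC : IsConnection LinearMap.id C)
    (hCn : ∀ n x, ∀ q ∈ degreeLT A L n, C x q ∈ degreeLT A L n)
    (hDl : IsLeadingMul D) (hD : ∀ x q, improve D hC x q = D x q) (n : ℕ)
    (q : SymmetricAlgebra A L) (hq : q ∈ degreeLT A L n) : IsFlatAt (perturb C D) q := by
  induction n generalizing q with
  | zero => intro x y; simp [eq_zero_of_mem_degreeLT_zero hq]
  | succ n ih =>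
    rw [← sub_add_cancel q (weightProj LinearMap.id n q)]
    refine (ih _ (sub_weightProj_mem_degreeLT hq)).add (isFlatAt_perturb_iff.2 fun x y => ?_)
    have hp : weightProj LinearMap.id n q ∈ degreeLT A L (n + 1) :=
      weightProj_mem_degreeLT n (n + 1) (Nat.lt_succ_self n) q
    have hpp : weightProj LinearMap.id n (weightProj LinearMap.id n q) =
      weightProj LinearMap.id n q := weightProj_self (fun _ => rfl) n q
    have hE := contract_diff_weightProj (e := LinearMap.id) (fun _ => rfl) n q
    generalize weightProj LinearMap.id n q = p at hp hpp hE ⊢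
    -- For `p` of degree `n` the product `y * p` has degree `n + 1`, hence the factor `n + 2`.
    -- Differentiating the factor `y` produces the first obstruction term.
    have h1 : ∀ x y, (n + 1 + 1) • (D x (ι A L y * p) - ι A L x * (ι A L y * p)) =
        obstruction C D x y p + contractObstruction D hC x
          ((LinearMap.mulLeft A (ι A L y)).rTensor L (diff LinearMap.id p)) := by
      intro x y
      have h := nsmul_sub_of_improve_eq hA hC hD (n + 1) x (ι A L y * p)
      rw [weightProj_succ_ι_mul, LinearMap.id_apply, sub_self, map_zero, zero_mul, zero_add, hpp,
        diff_ι_mul, map_add, contractObstruction_tmul] at h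
      exact h
    -- After antisymmetrization in `x` and `y`, the Bianchi identity collects the remaining terms
    -- into one obstruction. Euler's identity evaluates it as `n` times the obstruction at `p`.
    have h2 : contractObstruction D hC x
          ((LinearMap.mulLeft A (ι A L y)).rTensor L (diff LinearMap.id p)) -
        contractObstruction D hC y
          ((LinearMap.mulLeft A (ι A L x)).rTensor L (diff LinearMap.id p)) =
        obstructionLinear D hC x y (contract LinearMap.id (diff LinearMap.id p)) := by
      refine diff_induction (motive := fun s => contractObstruction D hC x
          ((LinearMap.mulLeft A (ι A L y)).rTensor L s) - contractObstruction D hC y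
          ((LinearMap.mulLeft A (ι A L x)).rTensor L s) =
          obstructionLinear D hC x y (contract LinearMap.id s)) hp (by simp) (fun s t hs ht => ?_)
        fun r z hr => ?_
      · simp only [map_add, ← hs, ← ht]; abel
      · have h3 := obstruction_cyclic (ih r hr)
          (fun x => ih _ (perturb_sub_mem hCn hDl n x r hr)) x z y
        simp only [LinearMap.rTensor_tmul, LinearMap.mulLeft_apply, contractObstruction_tmul,
          contract_tmul, obstructionLinear_apply, LinearMap.id_apply]
        rw [obstruction_swap C D y z, obstruction_swap C D x y] at h3
        linear_combination h3
    rw [hE, map_nsmul, obstructionLinear_apply] at h2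
    rw [← sub_eq_zero, ← Submodule.mem_bot A]
    refine mem_of_nsmul_mem hA (Nat.succ_ne_zero (n + 1)) ?_
    rw [Submodule.mem_bot]
    -- The two copies from `h1` and the `n` copies from `h2` match the factor `n + 2`.
    have h4 := h1 x y
    have h5 := h1 y x
    rw [obstruction_swap C D x y] at h5
    simp only [nsmul_eq_mul, Nat.succ_eq_add_one] at h2 h4 h5 ⊢
    push_cast at h2 h4 h5 ⊢
    linear_combination h4 - h5 + h2

/-- For a projective Lie-Rinehart algebra over a ring containing the rational numbers, there is a
flat connection on `S(L)` that coincides with the multiplication up to terms of lower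
degree. -/
theorem exists_flat_connection [Module.Projective A L] (hA : ∀ n : ℕ, n ≠ 0 → IsUnit (n : A)) :
    ∃ E : L →ₗ[A] (SymmetricAlgebra A L →+ SymmetricAlgebra A L),
      IsConnection LinearMap.id E ∧ (∀ q, IsFlatAt E q) ∧
      ∀ n x, ∀ q ∈ degreeLT A L n, E x q - ι A L x * q ∈ degreeLT A L n := by
  obtain ⟨C, hC, -, hCn⟩ := exists_graded_connection (A := A) (L := L) (W := L)
    (e := LinearMap.id) (fun _ => rfl)
  have hD := improveLimit_isLeadingMul hC hCn
  refine ⟨perturb C (improveLimit hC), perturb_isConnection _ hC, fun q => ?_,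
    perturb_sub_mem hCn hD⟩
  obtain ⟨n, hn⟩ := exists_mem_degreeLT q
  exact isFlatAt_of_improve_eq hA hC hCn hD (improve_improveLimit hC hCn) n q hn

end Flatness

/-! ### Modules over the enveloping algebra and flat connections -/

section LeftModule

variable {k A L : Type*} [CommRing k] [CommRing A] [Algebra k A] [LieRing L] [LieAlgebra k L]
  [Module A L] [LieRingModule L A]

/-- A property of the elements of a `U_A(L)`-module that is additive and stable under the actions of
`A` and `L` is stable under the action of `U_A(L)`. -/
theorem smul_mem_of_forall_mem {M : Type*} [AddCommGroup M] [Module (UEA k A L) M]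
    {N : AddSubgroup M} (hA : ∀ a, ∀ m ∈ N, ιA k A L a • m ∈ N)
    (hL : ∀ x, ∀ m ∈ N, ιL k A L x • m ∈ N) (u : UEA k A L) {m : M} (hm : m ∈ N) : u • m ∈ N := by
  obtain ⟨t, rfl⟩ : ∃ t, mk k A L t = u := RingQuot.mkAlgHom_surjective k (Rel k A L) u
  induction t using TensorAlgebra.induction generalizing m with
  | algebraMap r =>
    rw [AlgHom.commutes, ← (ιA k A L).commutes]
    exact hA _ m hm
  | ι y =>
    have h : mk k A L (TensorAlgebra.ι k y) = ιA k A L y.1 + ιL k A L y.2 := by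
      rw [ιA_apply, ιL_apply, ← map_add, ← map_add]
      simp
    rw [h, add_smul]
    exact add_mem (hA _ m hm) (hL _ m hm)
  | mul s t hs ht => rw [map_mul, mul_smul]; exact hs (ht hm)
  | add s t hs ht => rw [map_add, add_smul]; exact add_mem (hs hm) (ht hm)

/-- A `U_A(L)`-module viewed as an `A`-module along `ιA`. -/
def Restr (_k _A _L M : Type*) : Type _ := M

instance (M : Type*) [AddCommGroup M] : AddCommGroup (Restr k A L M) :=
  inferInstanceAs (AddCommGroup M)

instance (M : Type*) [AddCommGroup M] [Module (UEA k A L) M] :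
    Module (UEA k A L) (Restr k A L M) :=
  inferInstanceAs (Module (UEA k A L) M)

instance (M : Type*) [AddCommGroup M] [Module (UEA k A L) M] : Module A (Restr k A L M) :=
  Module.compHom (Restr k A L M) (ιA k A L).toRingHom

theorem restr_smul_def {M : Type*} [AddCommGroup M] [Module (UEA k A L) M] (a : A)
    (m : Restr k A L M) : a • m = ιA k A L a • m := rfl

variable (k A L) in
/-- The action of `L` on a `U_A(L)`-module. -/
def leftAct (M : Type*) [AddCommGroup M] [Module (UEA k A L) M] :
    L →ₗ[A] (Restr k A L M →+ Restr k A L M) where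
  toFun x := DistribSMul.toAddMonoidHom (Restr k A L M) (ιL k A L x)
  map_add' x y := by ext m; simp [add_smul]
  map_smul' a x := by ext m; simp [ιL_smul, mul_smul, restr_smul_def]

theorem leftAct_apply {M : Type*} [AddCommGroup M] [Module (UEA k A L) M] (x : L)
    (m : Restr k A L M) : leftAct k A L M x m = ιL k A L x • m := rfl

theorem leftAct_isConnection (M : Type*) [AddCommGroup M] [Module (UEA k A L) M] :
    IsConnection LinearMap.id (leftAct k A L M) := fun x a m => by
  simp only [leftAct_apply, restr_smul_def, LinearMap.id_apply, ← ιL_mul_ιA_sub, smul_smul,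
    sub_smul, add_sub_cancel]

theorem leftAct_comm {M : Type*} [AddCommGroup M] [Module (UEA k A L) M] (x y : L)
    (m : Restr k A L M) : leftAct k A L M x (leftAct k A L M y m) =
      leftAct k A L M y (leftAct k A L M x m) + leftAct k A L M ⁅x, y⁆ m := by
  simp only [leftAct_apply, ιL_lie, sub_smul, smul_smul, add_sub_cancel]

/-- A flat connection on an `A`-module is an action of the universal enveloping algebra. -/
theorem exists_ringHom_of_flat [LieRinehartRing A L] [LieRinehartAlgebra k A L] {X : Type*}
    [AddCommGroup X] [Module A X] {E : L →ₗ[A] (X →+ X)} (hE : IsConnection LinearMap.id E)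
    (hflat : ∀ x y q, E x (E y q) - E y (E x q) = E ⁅x, y⁆ q) :
    ∃ R : UEA k A L →+* AddMonoid.End X,
      (∀ a q, R (ιA k A L a) q = a • q) ∧ ∀ x q, R (ιL k A L x) q = E x q := by
  let _ : Module k X := Module.compHom X (algebraMap k A)
  have hsm : ∀ (c : k) (q : X), c • q = algebraMap k A c • q := fun _ _ => rfl
  -- Derivations kill constants, so the additive operators `E x` are `k`-linear and the universal
  -- property over `k` applies.
  have hE0 : ∀ (x : L) (c : k), ⁅x, algebraMap k A c⁆ = 0 := fun x c => by
    have h : ⁅x, (1 : A)⁆ = 0 := by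
      simpa using LieRinehartRing.leibniz_mul_right x (1 : A) 1
    rw [Algebra.algebraMap_eq_smul_one, LieModule.lie_smul c x (1 : A), h, smul_zero]
  have hEk : ∀ (x : L) (c : k) (q : X), E x (c • q) = c • E x q := fun x c q => by
    rw [hsm, hE, LinearMap.id_apply, hE0, zero_smul, add_zero, hsm]
  let f : A →ₐ[k] Module.End k X :=
    { toFun := fun a =>
        { toFun := fun q => a • q
          map_add' := smul_add a
          map_smul' := fun c q => smul_comm a (algebraMap k A c) q }
      map_one' := by ext q; exact one_smul A q
      map_mul' := fun a b => by ext q; exact mul_smul a b q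
      map_zero' := by ext q; exact zero_smul A q
      map_add' := fun a b => by ext q; exact add_smul a b q
      commutes' := fun c => rfl }
  let g : L →ₗ[k] Module.End k X :=
    { toFun := fun x =>
        { toFun := E x
          map_add' := map_add (E x)
          map_smul' := hEk x }
      map_add' := fun x y => by
        ext q
        exact DFunLike.congr_fun (map_add E x y) q
      map_smul' := fun c x => by
        ext q
        change E (c • x) q = algebraMap k A c • E x q
        rw [← algebraMap_smul A c x, map_smul]
        rfl }
  have hf : ∀ a q, f a q = a • q := fun _ _ => rfl
  have hg : ∀ x q, g x q = E x q := fun _ _ => rfl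
  let F := lift f g
    (fun x y => by
      ext q
      exact (hflat x y q).symm)
    (fun a x => by
      ext q
      change E (a • x) q = a • E x q
      rw [map_smul]; rfl)
    (fun x a => by
      ext q
      change E x (a • q) - a • E x q = ⁅x, a⁆ • q
      rw [hE, add_sub_cancel_left]; rfl)
  refine ⟨(Module.toAddMonoidEnd (Module.End k X) X).comp F.toRingHom, fun a q => ?_,
    fun x q => ?_⟩
  · change F (ιA k A L a) q = _
    rw [lift_ιA, hf]
  · change F (ιL k A L x) q = _
    rw [lift_ιL, hg]

end LeftModule

/-! ### Additive maps equal to the identity up to lower degree -/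

section Unipotent

variable {A W : Type*} [CommRing A] [AddCommGroup W] [Module A W]

theorem injective_of_sub_mem_degreeLT {g : SymmetricAlgebra A W →+ SymmetricAlgebra A W}
    (hg : ∀ n, ∀ q ∈ degreeLT A W (n + 1), g q - q ∈ degreeLT A W n) : Function.Injective g := by
  rw [injective_iff_map_eq_zero]
  intro q hq
  obtain ⟨n, hn⟩ := exists_mem_degreeLT q
  induction n with
  | zero => exact eq_zero_of_mem_degreeLT_zero hn
  | succ n ih =>
    refine ih ?_
    simpa [hq] using hg n q hn

theorem surjective_of_sub_mem_degreeLT {g : SymmetricAlgebra A W →+ SymmetricAlgebra A W}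
    (hg : ∀ n, ∀ q ∈ degreeLT A W (n + 1), g q - q ∈ degreeLT A W n) : Function.Surjective g := by
  intro q
  obtain ⟨n, hn⟩ := exists_mem_degreeLT q
  induction n generalizing q with
  | zero => exact ⟨0, by simp [eq_zero_of_mem_degreeLT_zero hn]⟩
  | succ n ih =>
    obtain ⟨p, hp⟩ := ih (g q - q) (hg n q hn)
    exact ⟨q - p, by rw [map_sub, hp, sub_sub_cancel]⟩

end Unipotent

/-! ### Induction of projective modules -/

section Projective

variable {k A L : Type*} [CommRing k] [CommRing A] [Algebra k A] [LieRing L] [LieAlgebra k L]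
  [Module A L] [LieRingModule L A]

variable (k A L) in
/-- The identity map from `RightReg k A L` to `UEA k A L`. -/
def toUEA : RightReg k A L ≃ₗ[UEA k A L] UEA k A L := LinearEquiv.refl (UEA k A L) (UEA k A L)

theorem toUEA_smul (a : A) (u : RightReg k A L) :
    toUEA k A L (a • u) = toUEA k A L u * ιA k A L a := rfl

/-- The module induced by a projective `A`-module is a projective `U_A(L)`-module. -/
theorem projective_rightReg_tensor (X : Type*) [AddCommGroup X] [Module A X]
    [Module.Projective A X] : Module.Projective (UEA k A L) (RightReg k A L ⊗[A] X) := by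
  obtain ⟨s, hs⟩ := Module.projective_def'.1 ‹Module.Projective A X›
  have hs' : ∀ p, ((s p).sum fun z b => b • z) = p := fun p => by
    simpa [Finsupp.linearCombination_apply] using DFunLike.congr_fun hs p
  -- The induced module is a direct summand of a free one: `r` sends basis vectors to `1 ⊗ z`, and
  -- the section `i` below expands `p` in coordinates by the splitting of `X`.
  let r : (X →₀ UEA k A L) →ₗ[UEA k A L] RightReg k A L ⊗[A] X :=
    Finsupp.lsum ℕ fun z =>
      { toFun := fun u => (toUEA k A L).symm u ⊗ₜ[A] z
        map_add' := fun u v => by rw [map_add, TensorProduct.add_tmul]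
        map_smul' := fun u v => rfl }
  have hr : ∀ (z : X) (u : UEA k A L), r (Finsupp.single z u) = (toUEA k A L).symm u ⊗ₜ[A] z :=
    fun z u => by
      simp only [r, Finsupp.lsum_single]
      rfl
  let i₀ : RightReg k A L →+ X →+ (X →₀ UEA k A L) :=
    AddMonoidHom.mk' (fun u => AddMonoidHom.mk' (fun p =>
        (s p).mapRange (fun a => toUEA k A L u * ιA k A L a) (by rw [map_zero, mul_zero]))
      (fun p q => by
        ext z
        simp only [map_add, Finsupp.mapRange_apply, Finsupp.add_apply, mul_add]))
      (fun u v => by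
        ext p z
        change toUEA k A L (u + v) * _ = toUEA k A L u * _ + toUEA k A L v * _
        rw [map_add, add_mul])
  have hi₀ : ∀ u p z, i₀ u p z = toUEA k A L u * ιA k A L (s p z) := fun _ _ _ => rfl
  let i₁ : RightReg k A L ⊗[A] X →+ (X →₀ UEA k A L) :=
    TensorProduct.liftAddHom i₀ (fun a u p => by
      ext z
      rw [hi₀, hi₀, map_smul s, Finsupp.smul_apply, smul_eq_mul, map_mul, ← mul_assoc, toUEA_smul])
  have hi₁ : ∀ u p, i₁ (u ⊗ₜ p) = i₀ u p := fun _ _ => rfl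
  let i : RightReg k A L ⊗[A] X →ₗ[UEA k A L] (X →₀ UEA k A L) :=
    { i₁ with
      map_smul' := fun u m => by
        change i₁ (u • m) = u • i₁ m
        induction m with
        | zero => simp
        | add p q hp hq => simp only [smul_add, map_add, hp, hq]
        | tmul v p =>
          rw [TensorProduct.smul_tmul', hi₁, hi₁]
          ext z
          rw [Finsupp.smul_apply, hi₀, hi₀, map_smul, smul_eq_mul, smul_eq_mul, mul_assoc] }
  refine Module.Projective.of_split i r ?_
  ext m
  change r (i₁ m) = m
  induction m with
  | zero => simp
  | add p q hp hq => simp only [map_add, hp, hq]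
  | tmul u p =>
    have h : i₀ u p = (s p).sum fun z b => Finsupp.single z (toUEA k A L u * ιA k A L b) := by
      ext z
      rw [hi₀, Finsupp.sum_apply]
      classical
      simp only [Finsupp.single_apply]
      rw [Finsupp.sum_ite_eq']
      split_ifs with hz
      · rfl
      · rw [Finsupp.notMem_support_iff.1 hz, map_zero, mul_zero]
    rw [hi₁, h, map_finsuppSum]
    conv_rhs => rw [← hs' p, Finsupp.sum, TensorProduct.tmul_sum]
    refine Finset.sum_congr rfl fun z _ => ?_
    beta_reduce
    rw [hr, ← TensorProduct.smul_tmul, ← toUEA_smul, LinearEquiv.symm_apply_apply]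

end Projective

/-! ### The absolute Poincaré-Birkhoff-Witt theorem -/

section PBW

variable {k A L : Type*} [CommRing k] [CommRing A] [Algebra k A] [LieRing L] [LieAlgebra k L]
  [Module A L] [LieRingModule L A]

/-- The `A`-linear map from `S(W)` to `U_A(L)` that maps `p` to the image of its
constant term. -/
noncomputable def constTerm (W : Type*) [AddCommGroup W] [Module A W] :
    SymmetricAlgebra A W →ₗ[A] Restr k A L (UEA k A L) where
  toFun p := ιA k A L (algebraMapInv p)
  map_add' p q := by rw [map_add, map_add]; rfl
  map_smul' a p := by rw [map_smul, smul_eq_mul, map_mul]; rfl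

variable [LieRinehartRing A L]

/-- The symmetrization map `S(W) → U_A(L)` associated with a linear map `s : W → L`. -/
theorem exists_symmetrization_UEA (hA : ∀ n : ℕ, n ≠ 0 → IsUnit (n : A))
    {R : UEA k A L →+* AddMonoid.End (SymmetricAlgebra A L)}
    {E : L →ₗ[A] (SymmetricAlgebra A L →+ SymmetricAlgebra A L)}
    (hRA : ∀ a q, R (ιA k A L a) q = a • q) (hRL : ∀ x q, R (ιL k A L x) q = E x q)
    (hE : ∀ n x, ∀ q ∈ degreeLT A L n, E x q - ι A L x * q ∈ degreeLT A L n)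
    {W : Type*} [AddCommGroup W] [Module A W] [Module.Projective A W] (s : W →ₗ[A] L) :
    ∃ φ : SymmetricAlgebra A W →ₗ[A] Restr k A L (UEA k A L),
      (∀ n, ∀ q ∈ degreeLT A W (n + 1), R (φ q) 1 - mapHom s q ∈ degreeLT A L n) ∧
      ((∀ v w, ∃ z, ⁅s v, s w⁆ = s z) →
        φ 1 = (1 : UEA k A L) ∧
        ∀ w, ∀ u ∈ LinearMap.range φ, ιL k A L (s w) • u ∈ LinearMap.range φ) := by
  obtain ⟨D, hD, hDe, hDn⟩ := exists_graded_connection (A := A) (L := L) (W := W)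
    (e := LinearMap.id) (fun _ => rfl)
  have hD' := hD.comp s
  have hT' := (leftAct_isConnection (k := k) (A := A) (L := L) (UEA k A L)).comp s
  obtain ⟨φ, hφ0, hφ⟩ := exists_symmetrization (e := LinearMap.id) hA (fun _ => rfl) hD' hT'
    (fun w => hDe (s w)) (constTerm W)
  let Ψ : Restr k A L (UEA k A L) →+ SymmetricAlgebra A L :=
    AddMonoidHom.mk' (fun u => R u 1) (fun u v => by
      change R ((show UEA k A L from u) + (show UEA k A L from v)) 1 = _
      rw [map_add]; rfl)
  have hφ0' : ∀ q, φ (weightProj LinearMap.id 0 q) = ιA k A L (algebraMapInv q) := fun q => by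
    rw [hφ0, weightProj_id_zero]
    change ιA k A L (algebraMapInv (algebraMap A _ (algebraMapInv q))) = _
    rw [algebraMap_leftInverse]
  refine ⟨φ, fun n q hq => ?_, fun hs => ⟨?_, fun w u hu => ?_⟩⟩
  · refine symmetrization_symbol (φ := φ) (f := s) (ρ := E) hA (fun _ => rfl) hD' hT'
      (fun n w => hDn n (s w)) hφ hE Ψ (fun w u => ?_) (fun w => rfl) (fun n q hq => ?_) n hq
    · change R (ιL k A L (s w) * (show UEA k A L from u)) 1 = E (s w) (R u 1)
      rw [map_mul, ← hRL]
      rfl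
    · have h : Ψ (φ (weightProj LinearMap.id 0 q)) = R (ιA k A L (algebraMapInv q)) 1 := by
        rw [hφ0']; rfl
      rw [h, hRA, weightProj_id_zero, AlgHom.commutes, Algebra.algebraMap_eq_smul_one, sub_self]
      exact zero_mem _
  · have h := hφ0' 1
    rwa [weightProj_zero_one, map_one algebraMapInv, map_one (ιA k A L)] at h
  · refine apply_mem_range_symmetrization (φ := φ) hA (e := LinearMap.id) (fun _ => rfl) hD' hT'
      (fun n w => hDn n (s w)) (fun _ => rfl) (fun v w => ?_) hφ w hu
    obtain ⟨z, hz⟩ := hs v w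
    refine ⟨z, fun m => ?_⟩
    simp only [LinearMap.comp_apply, ← hz]
    exact leftAct_comm _ _ _

/-- The Poincaré-Birkhoff-Witt theorem: the orbit map of `1 : S(L)` is injective. -/
theorem orbit_injective [Module.Projective A L] (hA : ∀ n : ℕ, n ≠ 0 → IsUnit (n : A))
    {R : UEA k A L →+* AddMonoid.End (SymmetricAlgebra A L)}
    {E : L →ₗ[A] (SymmetricAlgebra A L →+ SymmetricAlgebra A L)}
    (hRA : ∀ a q, R (ιA k A L a) q = a • q) (hRL : ∀ x q, R (ιL k A L x) q = E x q)
    (hE : ∀ n x, ∀ q ∈ degreeLT A L n, E x q - ι A L x * q ∈ degreeLT A L n)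
    {u : UEA k A L} (hu : R u 1 = 0) : u = 0 := by
  obtain ⟨φ, h1, h2⟩ := exists_symmetrization_UEA hA hRA hRL hE (LinearMap.id : L →ₗ[A] L)
  obtain ⟨hφ1, hφL⟩ := h2 fun v w => ⟨⁅v, w⁆, rfl⟩
  -- The range of `φ` contains `1` and is stable under `A` and `L`, so it is all of `U(L)`.
  have hmem : (u • (1 : UEA k A L)) ∈ (LinearMap.range φ).toAddSubgroup := by
    refine smul_mem_of_forall_mem (M := Restr k A L (UEA k A L)) (fun a m hm => ?_)
      (fun x m hm => hφL x m hm) u ⟨1, hφ1⟩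
    exact (LinearMap.range φ).smul_mem a hm
  rw [smul_eq_mul, mul_one] at hmem
  obtain ⟨q, hq⟩ := hmem
  let g : SymmetricAlgebra A L →+ SymmetricAlgebra A L :=
    AddMonoidHom.mk' (fun q => R (φ q) 1) (fun p q => by
      rw [map_add]
      change R ((show UEA k A L from φ p) + (show UEA k A L from φ q)) 1 = _
      rw [map_add]; rfl)
  have hg : Function.Injective g := injective_of_sub_mem_degreeLT fun n q hq => by
    have := h1 n q hq
    rwa [mapHom_id] at this
  have hq0 : q = 0 := by
    apply hg
    rw [map_zero]
    change R (φ q) 1 = 0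
    rw [← hu, ← hq]
  rw [← hq, hq0, map_zero]
  rfl

end PBW

/-! ### The relative theorem -/

section Relative

variable {k A L : Type*} [CommRing k] [CommRing A] [Algebra k A] [LieRing L] [LieAlgebra k L]
  [Module A L] [LieRingModule L A] [LieRinehartRing A L] [LieRinehartAlgebra k A L]
  {H : LieRinehartSubalgebra A L}

theorem subalgebra_smul_def (u : UEA k A H) (v : UEA k A L) : u • v = map (H.incl k) u * v := rfl

/-- The morphism of `U_A(H)`-modules from an induced module to `U_A(L)` that is determined by a
map on the `A`-module. -/
noncomputable def inducedHom {X : Type*} [AddCommGroup X] [Module A X]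
    (φ : X →ₗ[A] Restr k A L (UEA k A L)) :
    RightReg k A H ⊗[A] X →ₗ[UEA k A H] UEA k A L :=
  let f : RightReg k A H ⊗[A] X →+ UEA k A L := TensorProduct.liftAddHom
    (AddMonoidHom.mk' (fun u => AddMonoidHom.mk'
        (fun p => (toUEA k A H u) • (show UEA k A L from φ p))
        (fun p q => by rw [map_add]; exact smul_add (toUEA k A H u) _ _))
      (fun u v => by ext p; simp only [map_add]; exact add_smul _ _ _))
    (fun a u p => by
      change toUEA k A H (a • u) • (show UEA k A L from φ p) =
        toUEA k A H u • (show UEA k A L from φ (a • p))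
      rw [toUEA_smul, mul_smul, map_smul φ a p, subalgebra_smul_def (ιA k A H a), map_ιA]
      rfl)
  { f with
    map_smul' := fun u m => by
      change f (u • m) = u • f m
      induction m with
      | zero => simp
      | add p q hp hq => simp only [smul_add, map_add, hp, hq]
      | tmul v p => exact mul_smul u (toUEA k A H v) (show UEA k A L from φ p) }

theorem inducedHom_tmul {X : Type*} [AddCommGroup X] [Module A X]
    (φ : X →ₗ[A] Restr k A L (UEA k A L)) (u : RightReg k A H) (p : X) :
    inducedHom φ (u ⊗ₜ[A] p) = toUEA k A H u • (show UEA k A L from φ p) := rfl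

/-- The map `p ↦ 1 ⊗ p` to the induced module. -/
noncomputable def toInduced (X : Type*) [AddCommGroup X] [Module A X] :
    X →ₗ[A] Restr k A H (RightReg k A H ⊗[A] X) where
  toFun p := (toUEA k A H).symm 1 ⊗ₜ[A] p
  map_add' p q := TensorProduct.tmul_add _ _ _
  map_smul' a p := by
    rw [← TensorProduct.smul_tmul]
    change _ = ιA k A H a • ((toUEA k A H).symm 1 ⊗ₜ[A] p : RightReg k A H ⊗[A] X)
    rw [TensorProduct.smul_tmul']
    congr 1
    apply (toUEA k A H).injective
    rw [toUEA_smul, map_smul, LinearEquiv.apply_symm_apply, one_mul, smul_eq_mul, mul_one]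

theorem eq_top_of_toInduced_mem {X : Type*} [AddCommGroup X] [Module A X]
    {N : Submodule A (Restr k A H (RightReg k A H ⊗[A] X))} (h : ∀ p, toInduced X p ∈ N)
    (hN : ∀ x, ∀ m ∈ N, ιL k A H x • m ∈ N) (m : RightReg k A H ⊗[A] X) :
    (show Restr k A H (RightReg k A H ⊗[A] X) from m) ∈ N := by
  induction m with
  | zero => exact N.zero_mem
  | add p q hp hq => exact N.add_mem hp hq
  | tmul u p =>
    have h1 := smul_mem_of_forall_mem (N := N.toAddSubgroup) (fun a m hm => N.smul_mem a hm) hN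
      (toUEA k A H u) (h p)
    have h2 : toUEA k A H u • ((toUEA k A H).symm 1 ⊗ₜ[A] p : RightReg k A H ⊗[A] X) =
        u ⊗ₜ[A] p := by
      rw [TensorProduct.smul_tmul', ← map_smul, smul_eq_mul, mul_one, LinearEquiv.symm_apply_apply]
    rw [← h2]
    exact h1

/-- The Poincaré-Birkhoff-Witt theorem for a Lie-Rinehart algebra relative to a subalgebra. -/
theorem exists_linearEquiv (hA : ∀ n : ℕ, n ≠ 0 → IsUnit (n : A)) [Module.Projective A L]
    [Module.Projective A (L ⧸ H.toSubmodule)] :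
    Nonempty (UEA k A L ≃ₗ[UEA k A H]
      RightReg k A H ⊗[A] SymmetricAlgebra A (L ⧸ H.toSubmodule)) := by
  obtain ⟨s, hs⟩ := Module.projective_lifting_property H.toSubmodule.mkQ LinearMap.id
    H.toSubmodule.mkQ_surjective
  have hs' : ∀ v, H.toSubmodule.mkQ (s v) = v := fun v => DFunLike.congr_fun hs v
  -- The projection of `L` onto `H` along the image of the section `s`; its weight counts the
  -- factors lying in `H`.
  let e : L →ₗ[A] L := LinearMap.id - s ∘ₗ H.toSubmodule.mkQ
  have he_apply : ∀ x, e x = x - s (H.toSubmodule.mkQ x) := fun _ => rfl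
  have heH : ∀ x, e x ∈ H := fun x => by
    rw [← H.mem_toSubmodule, ← Submodule.Quotient.mk_eq_zero, ← Submodule.mkQ_apply, he_apply,
      map_sub, hs', sub_self]
  have he_of_mem : ∀ x ∈ H, e x = x := fun x hx => by
    rw [he_apply, Submodule.mkQ_apply, (Submodule.Quotient.mk_eq_zero _).2 hx, map_zero, sub_zero]
  have he : ∀ x, e (e x) = e x := fun x => he_of_mem _ (heH x)
  let eH : L →ₗ[A] H :=
    { toFun := fun x => ⟨e x, heH x⟩
      map_add' := fun x y => Subtype.ext (map_add e x y)
      map_smul' := fun a x => Subtype.ext (map_smul e a x) }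
  obtain ⟨E, hEc, hEf, hE⟩ := exists_flat_connection (A := A) (L := L) hA
  obtain ⟨R, hRA, hRL⟩ := exists_ringHom_of_flat (k := k) hEc fun x y q => hEf q x y
  obtain ⟨φ, hφ, -⟩ := exists_symmetrization_UEA hA hRA hRL hE s
  let Φ : RightReg k A H ⊗[A] SymmetricAlgebra A (L ⧸ H.toSubmodule) →ₗ[UEA k A H] UEA k A L :=
    inducedHom φ
  obtain ⟨D, hD, hDe, hDn⟩ := exists_graded_connection (A := A) (L := L) (W := L) he
  let T : L →ₗ[A] (Restr k A H (RightReg k A H ⊗[A] SymmetricAlgebra A (L ⧸ H.toSubmodule)) →+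
      Restr k A H (RightReg k A H ⊗[A] SymmetricAlgebra A (L ⧸ H.toSubmodule))) :=
    leftAct k A H (RightReg k A H ⊗[A] SymmetricAlgebra A (L ⧸ H.toSubmodule)) ∘ₗ eH
  have hT : IsConnection (LinearMap.id ∘ₗ e) T := fun x a m => leftAct_isConnection _ (eH x) a m
  have hD' := hD.comp e
  -- The weight zero part `S(s(L/H))` is sent to `1 ⊗ S(L/H)`, and the factors in `H` act through
  -- `U(H)`. The space `W = L` is used with `t = e`, so only the `H`-component of a vector acts.
  obtain ⟨χ, hχ0, hχ⟩ := exists_symmetrization hA he hD' hT (fun w => hDe (e w))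
    (toInduced (k := k) (H := H) (SymmetricAlgebra A (L ⧸ H.toSubmodule)) ∘ₗ
      (mapHom H.toSubmodule.mkQ).toLinearMap)
  have heH_of_mem : ∀ h : H, eH h = h := fun h => Subtype.ext (he_of_mem h h.2)
  have hχL : ∀ x, ∀ m ∈ LinearMap.range χ, T x m ∈ LinearMap.range χ := fun x m hm => by
    refine apply_mem_range_symmetrization hA he hD' hT (fun n w => hDn n (e w)) (fun w => ?_)
      (fun v w => ⟨⁅e v, e w⁆, fun m => ?_⟩) hχ x hm
    · change leftAct k A H _ (eH (e w)) = leftAct k A H _ (eH w)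
      rw [show eH (e w) = eH w from heH_of_mem (eH w)]
    · have h : eH ⁅e v, e w⁆ = ⁅eH v, eH w⁆ := heH_of_mem ⁅eH v, eH w⁆
      change leftAct k A H _ (eH v) (leftAct k A H _ (eH w) m) =
        leftAct k A H _ (eH w) (leftAct k A H _ (eH v) m) + leftAct k A H _ (eH ⁅e v, e w⁆) m
      rw [h, leftAct_comm]
  have hproj : ∀ q, weightProj e 0 q = mapHom s (mapHom H.toSubmodule.mkQ q) := fun q => by
    rw [weightProj_zero_eq_mapHom, mapHom_mapHom, sub_sub_cancel]
  have hχ_surj : ∀ m, ∃ q, χ q = m := by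
    refine eq_top_of_toInduced_mem (N := LinearMap.range χ) (fun p => ?_) fun x m hm => ?_
    · refine ⟨mapHom s p, ?_⟩
      have hp : weightProj e 0 (mapHom s p) = mapHom s p := by
        rw [hproj, mapHom_mapHom H.toSubmodule.mkQ, hs, mapHom_id]
      have h := hχ0 (mapHom s p)
      rw [hp] at h
      rw [h, LinearMap.comp_apply, AlgHom.toLinearMap_apply, mapHom_mapHom, hs, mapHom_id]
    · have h := hχL x m hm
      rwa [show T x m = ιL k A H (eH x) • m from rfl, heH_of_mem] at h
  let Ψ : Restr k A H (RightReg k A H ⊗[A] SymmetricAlgebra A (L ⧸ H.toSubmodule)) →+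
      SymmetricAlgebra A L :=
    AddMonoidHom.mk' (fun m => R (Φ m) 1) (fun m m' => by
      have h : Φ (m + m') = Φ m + Φ m' := map_add Φ m m'
      rw [h, map_add]; rfl)
  have hΨ : ∀ m, Ψ m = R (Φ m) 1 := fun _ => rfl
  -- Initial case: in weight zero, `Φ` after `χ` is `φ` after the quotient map, and the symbol
  -- estimate for `φ` applies. The general case follows because `Φ` intertwines the actions of `H`.
  have hsymb : ∀ n, ∀ q ∈ degreeLT A L (n + 1), Ψ (χ q) - q ∈ degreeLT A L n := by
    intro n q hq
    have h := symmetrization_symbol (φ := χ) (f := LinearMap.id) (ρ := E) hA he hD' hT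
      (fun n w => hDn n (e w)) hχ hE Ψ (fun w m => ?_) (fun w => rfl) (fun n q hq => ?_) n hq
    · rwa [mapHom_id] at h
    · rw [hΨ, hΨ]
      have h : Φ (T w m) = ιL k A L (e w) * Φ m := by
        change Φ (ιL k A H (eH w) • m) = _
        refine (map_smul Φ (ιL k A H (eH w)) m).trans ?_
        rw [subalgebra_smul_def, map_ιL]
        rfl
      rw [h, map_mul, ← hRL]
      rfl
    · have h : Φ (χ (weightProj e 0 q)) =
          (show UEA k A L from φ (mapHom H.toSubmodule.mkQ (weightProj e 0 q))) := by
        rw [hχ0]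
        change Φ ((toUEA k A H).symm 1 ⊗ₜ[A] mapHom H.toSubmodule.mkQ (weightProj e 0 q)) = _
        rw [inducedHom_tmul, LinearEquiv.apply_symm_apply]
        exact one_smul (UEA k A H) _
      rw [hΨ, h, mapHom_id]
      have h1 := hφ n (mapHom H.toSubmodule.mkQ (weightProj e 0 q))
        (mapHom_mem_degreeLT _ (weightProj_mem_degreeLT_of_mem e 0 hq))
      rwa [← hproj, weightProj_self he] at h1
  let g : SymmetricAlgebra A L →+ SymmetricAlgebra A L := Ψ.comp χ.toAddMonoidHom
  have hg : ∀ q, g q = R (Φ (χ q)) 1 := fun _ => rfl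
  have hbij : Function.Bijective Φ := by
    constructor
    · rw [injective_iff_map_eq_zero]
      intro m hm
      obtain ⟨q, rfl⟩ := hχ_surj m
      -- Surjectivity of `χ` reduces injectivity of `Φ` to that of the unipotent composite `g`.
      have hq : q = 0 := by
        apply injective_of_sub_mem_degreeLT (g := g) hsymb
        rw [hg, hm, map_zero, map_zero]
        rfl
      rw [hq]
      exact map_zero χ
    · intro u
      -- Some `Φ (χ q)` has the same orbit value as `u`, and the orbit map is injective.
      obtain ⟨q, hq⟩ := surjective_of_sub_mem_degreeLT (g := g) hsymb (R u 1)
      refine ⟨χ q, ?_⟩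
      rw [← sub_eq_zero]
      apply orbit_injective hA hRA hRL hE
      rw [hg] at hq
      rw [map_sub]
      change R (Φ (χ q)) 1 - R u 1 = 0
      rw [hq, sub_self]
  exact ⟨(LinearEquiv.ofBijective Φ hbij).symm⟩

end Relative

end LieRinehartUEA

theorem proposition1p10 {k A L : Type*} [Field k] [CharZero k] [CommRing A] [Algebra k A]
    [LieRing L] [LieAlgebra k L] [Module A L] [LieRingModule L A] [LieRinehartRing A L]
    [LieRinehartAlgebra k A L] (H : LieRinehartSubalgebra A L)
    [Module.Projective A H] [Module.Projective A L] [Module.Projective A (L ⧸ H.toSubmodule)] :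
    Nonempty (LieRinehartUEA.UEA k A L ≃ₗ[LieRinehartUEA.UEA k A H]
      LieRinehartUEA.RightReg k A H ⊗[A] SymmetricAlgebra A (L ⧸ H.toSubmodule)) ∧
    Module.Projective (LieRinehartUEA.UEA k A H) (LieRinehartUEA.UEA k A L) := by
  -- Characteristic zero enters only here, as invertibility of positive integers in `A`.
  have hA : ∀ n : ℕ, n ≠ 0 → IsUnit (n : A) := fun n hn => by
    rw [← map_natCast (algebraMap k A)]
    exact (IsUnit.mk0 (n : k) (Nat.cast_ne_zero.2 hn)).map (algebraMap k A)
  obtain ⟨f⟩ := LieRinehartUEA.exists_linearEquiv (k := k) (H := H) hA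
  have := LieRinehartUEA.projective_rightReg_tensor (k := k) (A := A) (L := H)
    (SymmetricAlgebra A (L ⧸ H.toSubmodule))
  exact ⟨⟨f⟩, Module.Projective.of_equiv f.symm⟩
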